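/- Let $E=\mathrm{ThCartSp}$ be the category of thickened Cartesian spaces $\mathbb R^k\times\mathbb D$, i.e. the opposite of the category of commutative $\mathbb R$-algebras of the form $C^\infty(\mathbb R^k)\otimes \mathcal O(\mathbb D)$ with $\mathcal O(\mathbb D)=\mathbb R\oplus V$ a Weil algebra ($V$ finite dimensional and nilpotent), and let $\mathcal E=\mathrm{ThSmthSet}$ be the category of sheaves of sets on $E$ for the coverage by families $\{U_i\times\mathbb D\to\mathbb R^k\times\mathbb D\}$ with $\{U_i\}$ a differentiably good open cover of $\mathbb R^k$. Write $\mathbb R$ also for the representable $y(\mathbb R)$, and $\mathbb D^n(1)$ for the dual of $\mathbb R[\epsilon_1,\dots,\epsilon_n]/(\epsilon_1,\dots,\epsilon_n)^2$. The synthetic tangent bundle of $\mathcal F\in\mathcal E$ is the mapping space $T\mathcal F=[\mathbb D^1(1),\mathcal F]\to\mathcal F$; it carries the canonical scaling $\mathbb R\times T\mathcal F\to T\mathcal F$, $(r\cdot v)(d)=v(r\cdot d)$. The space $\mathcal F$ is infinitesimally linear if for every $n$ the restrictions along the $n$ axes give an isomorphism $[\mathbb D^n(1),\mathcal F]\cong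 T\mathcal F\times_{\mathcal F}\cdots\times_{\mathcal F}T\mathcal F$; then $T\mathcal F$ has the fiberwise addition $T\mathcal F\times_{\mathcal F}T\mathcal F\cong[\mathbb D^2(1),\mathcal F]\to T\mathcal F$ given by restriction to the diagonal $\mathbb D^1(1)\to\mathbb D^2(1)$. This applies to every probe $e\in E$. Let $\mathbb R_{\mathbb D^1(1)}$ have $e$-plots $\mathrm{Hom}_{\mathcal E}(Te,\mathbb R)$, and let $\widehat{\mathbf\Omega}^1\subset\mathbb R_{\mathbb D^1(1)}$ have as $e$-plots the fiberwise linear maps $\mathrm{Hom}^{\mathrm{fib.lin.}}_{\mathcal E}(Te,\mathbb R)$. Then $\mathbb R$, $\mathbb R_{\mathbb D^1(1)}$, $\widehat{\mathbf\Omega}^1$ and $T\mathcal F$ (for every $\mathcal F\in\mathcal E$) are objects of $\mathcal E$, and for every $\mathcal F\in\mathcal E$: (i) The map $\mathrm{Hom}_{\mathcal E}(T\mathcal F,\mathbb R)\to\mathrm{Hom}_{\mathcal E}(\mathcal F,\mathbb R_{\mathbb D^1(1)})$ sending $f$ to $\big(p\mapsto f\circ Tp\big)$ on plots $p:e\to\mathcal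 F$ is a bijection, and composing its inverse with the inclusion $\widehat{\mathbf\Omega}^1\hookrightarrow\mathbb R_{\mathbb D^1(1)}$ gives a canonical injection $$\mathrm{Hom}_{\mathcal E}(\mathcal F,\widehat{\mathbf\Omega}^1)\hookrightarrow\mathrm{Hom}_{\mathcal E}(T\mathcal F,\mathbb R).$$ (ii) If $\mathcal F$ is infinitesimally linear, or more generally if $T\mathcal F\to\mathcal F$ is equipped with any fiberwise $\mathbb R$-module structure whose scalar multiplication is the canonical scaling, then the image of this injection is exactly the set of fiberwise linear maps with respect to that structure, so that $$\mathrm{Hom}_{\mathcal E}(\mathcal F,\widehat{\mathbf\Omega}^1)\cong\mathrm{Hom}^{\mathrm{fib.lin.}}_{\mathcal E}(T\mathcal F,\mathbb R).$$ -/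

import Mathlib

open CategoryTheory Opposite MonoidalCategory TensorProduct
open scoped Manifold ContDiff

noncomputable section

namespace ThSm

/-! ### Infinitesimal points (duals of Weil algebras) -/

/-- A Weil algebra: a commutative real algebra of the form `ℝ ⊕ V` as a vector space, where `ℝ` is
the line of constants and `V` is finite dimensional and consists of nilpotent elements. -/
structure IsWeilAlgebra (W : Type) [CommRing W] [Algebra ℝ W] : Prop where
  nontrivial : Nontrivial W
  finite : Module.Finite ℝ W
  exists_compl : ∃ V : Submodule ℝ W, IsCompl (1 : Submodule ℝ W) V ∧ ∀ v ∈ V, IsNilpotent v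

/-- An infinitesimally thickened point `𝔻`, given by its Weil algebra of functions. A Weil algebra
is finitely generated, so up to isomorphism it is a quotient of a polynomial algebra; using these
quotients keeps the category of probes small. -/
structure InfPoint where
  gens : ℕ
  ideal : Ideal (MvPolynomial (Fin gens) ℝ)
  isWeil : IsWeilAlgebra (MvPolynomial (Fin gens) ℝ ⧸ ideal)

/-- The function algebra `𝒪(𝔻)`. -/
def InfPoint.Fn (D : InfPoint) : Type := MvPolynomial (Fin D.gens) ℝ ⧸ D.ideal

instance (D : InfPoint) : CommRing D.Fn :=
  inferInstanceAs (CommRing (MvPolynomial (Fin D.gens) ℝ ⧸ D.ideal))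

instance (D : InfPoint) : Algebra ℝ D.Fn :=
  inferInstanceAs (Algebra ℝ (MvPolynomial (Fin D.gens) ℝ ⧸ D.ideal))

/-- The projection from polynomials to `𝒪(𝔻)`. -/
def InfPoint.quot (D : InfPoint) : MvPolynomial (Fin D.gens) ℝ →ₐ[ℝ] D.Fn :=
  Ideal.Quotient.mkₐ ℝ D.ideal

lemma isWeilAlgebra_disk (m l : ℕ) :
    IsWeilAlgebra (MvPolynomial (Fin m) ℝ ⧸ (MvPolynomial.idealOfVars (Fin m) ℝ) ^ (l + 1)) := by
  set I := (MvPolynomial.idealOfVars (Fin m) ℝ) ^ (l + 1) with hI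
  have hne : I ≠ ⊤ := by
    intro h
    have h1 : (1 : MvPolynomial (Fin m) ℝ) ∈ I := h ▸ Submodule.mem_top
    rw [hI, MvPolynomial.mem_pow_idealOfVars_iff'] at h1
    simpa using h1 0 (by simp)
  have hnt : Nontrivial (MvPolynomial (Fin m) ℝ ⧸ I) := Ideal.Quotient.nontrivial_iff.2 hne
  refine ⟨hnt, ?_, ?_⟩
  · have hfin := Finsupp.finite_of_degree_lt (σ := Fin m) (l + 1)
    refine ⟨?_⟩
    refine (Submodule.fg_def).2 ⟨(fun x : Fin m →₀ ℕ =>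
      Ideal.Quotient.mk I (MvPolynomial.monomial x (1 : ℝ))) '' {x | x.degree < l + 1},
      hfin.image _, ?_⟩
    rw [eq_top_iff]
    rintro q -
    obtain ⟨p, rfl⟩ := Ideal.Quotient.mk_surjective q
    rw [p.as_sum, map_sum]
    refine Submodule.sum_mem _ fun x _ => ?_
    by_cases hx : x.degree < l + 1
    · have : Ideal.Quotient.mk I (MvPolynomial.monomial x (p.coeff x)) =
          (p.coeff x) • Ideal.Quotient.mk I (MvPolynomial.monomial x (1 : ℝ)) := by
        rw [← Ideal.Quotient.mkₐ_eq_mk ℝ, ← map_smul, MvPolynomial.smul_monomial, smul_eq_mul,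
          mul_one]
      rw [this]
      exact Submodule.smul_mem _ _ (Submodule.subset_span ⟨x, hx, rfl⟩)
    · have : Ideal.Quotient.mk I (MvPolynomial.monomial x (p.coeff x)) = 0 := by
        rw [Ideal.Quotient.eq_zero_iff_mem, hI, MvPolynomial.mem_pow_idealOfVars_iff']
        intro y hy
        rw [MvPolynomial.coeff_monomial, if_neg]
        rintro rfl
        exact hx hy
      rw [this]
      exact Submodule.zero_mem _
  · set V : Submodule ℝ (MvPolynomial (Fin m) ℝ ⧸ I) :=
      ((MvPolynomial.idealOfVars (Fin m) ℝ).restrictScalars ℝ).map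
        (Ideal.Quotient.mkₐ ℝ I).toLinearMap with hV
    have hnil : ∀ v ∈ V, IsNilpotent v := by
      rintro _ ⟨p, hp, rfl⟩
      refine ⟨l + 1, ?_⟩
      change (Ideal.Quotient.mk I p) ^ (l + 1) = 0
      rw [← map_pow, Ideal.Quotient.eq_zero_iff_mem, hI]
      exact Ideal.pow_mem_pow hp _
    refine ⟨V, ⟨?_, ?_⟩, hnil⟩
    · rw [Submodule.disjoint_def]
      intro x hx hxV
      obtain ⟨r, rfl⟩ := Submodule.mem_one.1 hx
      have h1 := hnil _ hxV
      have h2 : IsNilpotent r :=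
        (IsNilpotent.map_iff (algebraMap ℝ (MvPolynomial (Fin m) ℝ ⧸ I)).injective).1 h1
      rw [h2.eq_zero, map_zero]
    · rw [codisjoint_iff, eq_top_iff]
      rintro q -
      obtain ⟨p, rfl⟩ := Ideal.Quotient.mk_surjective q
      refine Submodule.mem_sup.2 ⟨algebraMap ℝ _ (p.coeff 0), Submodule.mem_one.2 ⟨_, rfl⟩,
        Ideal.Quotient.mk I (p - MvPolynomial.C (p.coeff 0)), ⟨_, ?_, rfl⟩, ?_⟩
      · change _ ∈ MvPolynomial.idealOfVars (Fin m) ℝ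
        rw [← pow_one (MvPolynomial.idealOfVars (Fin m) ℝ), MvPolynomial.mem_pow_idealOfVars_iff']
        intro x hx
        have : x = 0 := by
          rw [← Finsupp.degree_eq_zero_iff]
          omega
        subst this
        simp
      · rw [map_sub]
        change Ideal.Quotient.mk I (MvPolynomial.C (p.coeff 0)) + _ = _
        ring

/-- The infinitesimal disk `𝔻^m(l)`, dual to `ℝ[ε₁, …, ε_m] / (ε₁, …, ε_m)^(l+1)`. -/
abbrev disk (m l : ℕ) : InfPoint where
  gens := m
  ideal := (MvPolynomial.idealOfVars (Fin m) ℝ) ^ (l + 1)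
  isWeil := isWeilAlgebra_disk m l

/-! ### Thickened Cartesian spaces -/

/-- The Euclidean space `ℝ^k`. -/
abbrev Eu (k : ℕ) : Type := EuclideanSpace ℝ (Fin k)

/-- The algebra `C^∞(ℝ^k)`, as a subalgebra of the algebra of all functions. -/
def smooth (k : ℕ) : Subalgebra ℝ (Eu k → ℝ) where
  carrier := {f | ContDiff ℝ ∞ f}
  mul_mem' {f g} hf hg := by
    change ContDiff ℝ ∞ (f * g)
    exact ContDiff.mul (show ContDiff ℝ ∞ f from hf) (show ContDiff ℝ ∞ g from hg)
  add_mem' {f g} hf hg := by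
    change ContDiff ℝ ∞ (f + g)
    exact ContDiff.add (show ContDiff ℝ ∞ f from hf) (show ContDiff ℝ ∞ g from hg)
  algebraMap_mem' r := by
    change ContDiff ℝ ∞ (fun _ => r)
    exact contDiff_const

/-- The algebra `C^∞(ℝ^k)`. -/
def Smooth (k : ℕ) : Type := smooth k

instance (k : ℕ) : CommRing (Smooth k) := inferInstanceAs (CommRing (smooth k))

instance (k : ℕ) : Algebra ℝ (Smooth k) := inferInstanceAs (Algebra ℝ (smooth k))

/-- The function underlying an element of `C^∞(ℝ^k)`. -/
def Smooth.toFun {k : ℕ} (f : Smooth k) : Eu k → ℝ := Subtype.val f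

lemma Smooth.contDiff {k : ℕ} (f : Smooth k) : ContDiff ℝ ∞ f.toFun := Subtype.property f

/-- The element of `C^∞(ℝ^k)` given by a smooth function. -/
def Smooth.mk {k : ℕ} (f : Eu k → ℝ) (hf : ContDiff ℝ ∞ f) : Smooth k :=
  (⟨f, hf⟩ : smooth k)

/-- Pullback of smooth functions along a smooth map. -/
def pullback {k l : ℕ} (g : Eu k → Eu l) (hg : ContDiff ℝ ∞ g) : Smooth l →ₐ[ℝ] Smooth k where
  toFun f := Smooth.mk (f.toFun ∘ g) (f.contDiff.comp hg)
  map_one' := rfl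
  map_mul' _ _ := rfl
  map_zero' := rfl
  map_add' _ _ := rfl
  commutes' _ := rfl

/-- A thickened Cartesian space `ℝ^k × 𝔻`. -/
structure ThCart where
  dim : ℕ
  inf : InfPoint

/-- The function algebra `𝒪(ℝ^k × 𝔻) = C^∞(ℝ^k) ⊗ 𝒪(𝔻)`. -/
def ThCart.Fn (e : ThCart) : Type := Smooth e.dim ⊗[ℝ] e.inf.Fn

instance (e : ThCart) : CommRing e.Fn :=
  inferInstanceAs (CommRing (Smooth e.dim ⊗[ℝ] e.inf.Fn))

instance (e : ThCart) : Algebra ℝ e.Fn :=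
  inferInstanceAs (Algebra ℝ (Smooth e.dim ⊗[ℝ] e.inf.Fn))

/-- The function `f ⊗ w` on `ℝ^k × 𝔻`. -/
def ThCart.tmul (e : ThCart) (f : Smooth e.dim) (w : e.inf.Fn) : e.Fn :=
  (f ⊗ₜ[ℝ] w : Smooth e.dim ⊗[ℝ] e.inf.Fn)

/-- Maps of thickened Cartesian spaces are `ℝ`-algebra maps of function algebras, reversed. -/
instance : SmallCategory ThCart where
  Hom X Y := Y.Fn →ₐ[ℝ] X.Fn
  id X := AlgHom.id ℝ X.Fn
  comp f g := AlgHom.comp f g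

/-- The algebra map dual to a map of thickened Cartesian spaces. -/
def dual {X Y : ThCart} (f : X ⟶ Y) : Y.Fn →ₐ[ℝ] X.Fn := f

/-- The map with a given dual algebra map. -/
def ofDual {X Y : ThCart} (f : Y.Fn →ₐ[ℝ] X.Fn) : X ⟶ Y := f

/-- `j : ℝ^k → ℝ^k` is a diffeomorphism onto the open subset `U`. -/
def IsChart {k : ℕ} (j : Eu k → Eu k) (U : Set (Eu k)) : Prop :=
  IsOpen U ∧ ContDiff ℝ ∞ j ∧ Set.range j = U ∧ ∃ g : Eu k → Eu k, ContDiffOn ℝ ∞ g U ∧ ∀ x, g (j x) = x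

/-- A differentiably good open cover of `ℝ^k`, with a parametrization `ℝ^k ≅ U i` of each member:
all nonempty finite intersections of members are diffeomorphic to `ℝ^k`. -/
structure GoodCover (k : ℕ) where
  ι : Type
  U : ι → Set (Eu k)
  chart : ι → Eu k → Eu k
  isChart : ∀ i, IsChart (chart i) (U i)
  cover : ⋃ i, U i = Set.univ
  good : ∀ s : Finset ι, s.Nonempty → (⋂ i ∈ s, U i).Nonempty →
    ∃ j : Eu k → Eu k, IsChart j (⋂ i ∈ s, U i)

/-- The map `j × id : ℝ^k × 𝔻 → ℝ^k × 𝔻`. -/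
def thicken (e : ThCart) (j : Eu e.dim → Eu e.dim) (hj : ContDiff ℝ ∞ j) : e ⟶ e :=
  ofDual (Algebra.TensorProduct.map (pullback j hj) (AlgHom.id ℝ e.inf.Fn))

/-- The covering families `{U_i × 𝔻 → ℝ^k × 𝔻}` of differentiably good open covers. -/
def goodOpenCovers : Precoverage ThCart where
  coverings e := {R | ∃ 𝒰 : GoodCover e.dim,
    R = Presieve.ofArrows (fun _ : 𝒰.ι => e) (fun i => thicken e (𝒰.chart i) (𝒰.isChart i).2.1)}

/-- The Grothendieck topology generated by the differentiably good open covers. -/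
def goodTopology : GrothendieckTopology ThCart := goodOpenCovers.toGrothendieck

/-- Thickened smooth sets: sheaves of sets on thickened Cartesian spaces. They form a full
subcategory of the presheaves, i.e. a map of sheaves is a natural transformation. -/
abbrev ThSmoothSet := Sheaf goodTopology (Type)

/-- Presheaves of sets on thickened Cartesian spaces. -/
abbrev PSh := ThCartᵒᵖ ⥤ Type

/-! ### The line, the first-order disks, and maps into them -/

/-- `ℝ` as a thickened Cartesian space `ℝ^1 × 𝔻^0(0)`. -/
abbrev line : ThCart := ⟨1, disk 0 0⟩

/-- The first-order disk `𝔻^n(1)` as a thickened Cartesian space `ℝ^0 × 𝔻^n(1)`. -/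
abbrev D (n : ℕ) : ThCart := ⟨0, disk n 1⟩

/-- The coordinate function `t ∈ C^∞(ℝ)`. -/
def lineCoord : Smooth 1 :=
  Smooth.mk (fun x => x 0) (by fun_prop)

/-- The function on `e` underlying a map `e → ℝ`, i.e. the pullback of the coordinate of `ℝ`. The
addition and multiplication of maps to `ℝ` are those of the underlying functions. -/
def fn {e : ThCart} (r : e ⟶ line) : e.Fn := dual r (line.tmul lineCoord 1)

/-- The coordinate function `ε_i` on `𝔻^n(1)`. -/
def eps (n : ℕ) (i : Fin n) : (D n).Fn :=
  (D n).tmul 1 ((disk n 1).quot (MvPolynomial.X i))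

/-- The pullback of the coordinate `ε_i` along a map `e → 𝔻^n(1)`. -/
def dcoord {n : ℕ} {e : ThCart} (d : e ⟶ D n) (i : Fin n) : e.Fn := dual d (eps n i)

/-- Functions `a_i` on `e` with `a_i a_j = 0`. -/
def IsNil {n : ℕ} {e : ThCart} (a : Fin n → e.Fn) : Prop := ∀ i j, a i * a j = 0

/-- Evaluation of smooth functions at the origin. -/
def evalZero (k : ℕ) : Smooth k →ₐ[ℝ] ℝ where
  toFun f := f.toFun 0
  map_one' := rfl
  map_mul' _ _ := rfl
  map_zero' := rfl
  map_add' _ _ := rfl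
  commutes' _ := rfl

lemma aeval_eq_zero {n : ℕ} {e : ThCart} (a : Fin n → e.Fn) (ha : IsNil a) :
    ∀ p ∈ (disk n 1).ideal, MvPolynomial.aeval (R := ℝ) a p = 0 := by
  intro p hp
  have h1 : (MvPolynomial.idealOfVars (Fin n) ℝ) ^ (1 + 1) ≤
      RingHom.ker (MvPolynomial.aeval (R := ℝ) a) := by
    rw [pow_succ, pow_one, MvPolynomial.idealOfVars, Ideal.span_mul_span', Ideal.span_le]
    rintro _ ⟨_, ⟨i, rfl⟩, _, ⟨j, rfl⟩, rfl⟩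
    simpa using! ha i j
  exact h1 hp

/-- The map `e → 𝔻^n(1)` dual to `ε_i ↦ a_i`. -/
def toD {n : ℕ} {e : ThCart} (a : Fin n → e.Fn) (ha : IsNil a) : e ⟶ D n :=
  ofDual (Algebra.TensorProduct.lift (A := Smooth 0) (B := (disk n 1).Fn) ((Algebra.ofId ℝ e.Fn).comp (evalZero 0))
    (Ideal.Quotient.liftₐ (disk n 1).ideal (MvPolynomial.aeval a) (aeval_eq_zero a ha))
    (fun _ _ => Commute.all _ _))

lemma isNil_eps (n : ℕ) : IsNil (eps n) := by
  intro i j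
  have h : (disk n 1).quot (MvPolynomial.X i) * (disk n 1).quot (MvPolynomial.X j) = 0 := by
    rw [← map_mul]
    refine Ideal.Quotient.eq_zero_iff_mem.2 ?_
    change _ ∈ (MvPolynomial.idealOfVars (Fin n) ℝ) ^ (1 + 1)
    rw [pow_succ, pow_one]
    exact Ideal.mul_mem_mul (Ideal.subset_span ⟨i, rfl⟩) (Ideal.subset_span ⟨j, rfl⟩)
  refine (Algebra.TensorProduct.tmul_mul_tmul (R := ℝ) (1 : Smooth 0) (1 : Smooth 0)
    ((disk n 1).quot (MvPolynomial.X i)) ((disk n 1).quot (MvPolynomial.X j))).trans ?_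
  rw [h, TensorProduct.tmul_zero]
  rfl

lemma isNil_dcoord {n : ℕ} {e : ThCart} (d : e ⟶ D n) : IsNil (dcoord d) := by
  intro i j
  rw [dcoord, dcoord, ← map_mul, isNil_eps n i j, map_zero]

lemma dcoord_toD {n : ℕ} {e : ThCart} (a : Fin n → e.Fn) (ha : IsNil a) (i : Fin n) :
    dcoord (toD a ha) i = a i := by
  refine (Algebra.TensorProduct.lift_tmul (A := Smooth 0) (B := (disk n 1).Fn) _ _
    (fun _ _ => Commute.all _ _) 1
    ((disk n 1).quot (MvPolynomial.X i))).trans ?_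
  rw [map_one, one_mul]
  exact MvPolynomial.aeval_X _ _

lemma dual_comp {X Y Z : ThCart} (f : X ⟶ Y) (g : Y ⟶ Z) (a : Z.Fn) :
    dual (f ≫ g) a = dual f (dual g a) := rfl

lemma fn_comp {X Y : ThCart} (f : X ⟶ Y) (r : Y ⟶ line) : fn (f ≫ r) = dual f (fn r) := rfl

lemma dcoord_comp {n : ℕ} {X Y : ThCart} (f : X ⟶ Y) (d : Y ⟶ D n) (i : Fin n) :
    dcoord (f ≫ d) i = dual f (dcoord d i) := rfl

/-- A map to `𝔻^n(1)` is determined by the pullbacks of the coordinates. -/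
lemma hom_D_ext {n : ℕ} {e : ThCart} {d d' : e ⟶ D n} (h : ∀ i, dcoord d i = dcoord d' i) :
    d = d' := by
  refine Algebra.TensorProduct.ext (A := Smooth 0) (B := (disk n 1).Fn) ?_ ?_
  · refine AlgHom.ext fun f => ?_
    have hf : f = algebraMap ℝ (Smooth 0) (f.toFun 0) := by
      refine Subtype.ext (funext fun x => ?_)
      rw [Subsingleton.elim x 0]
      rfl
    rw [hf, AlgHom.commutes, AlgHom.commutes]
  · refine Ideal.Quotient.algHom_ext _ ?_
    exact MvPolynomial.algHom_ext (fun i => h i)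

lemma IsNil.mul_left {n : ℕ} {e : ThCart} {a : Fin n → e.Fn} (ha : IsNil a) {b : e.Fn} :
    IsNil (fun i => b * a i) := fun i j => by
  change b * a i * (b * a j) = 0
  rw [mul_mul_mul_comm, ha i j, mul_zero]

lemma isNil_zero {n : ℕ} {e : ThCart} : IsNil (fun _ : Fin n => (0 : e.Fn)) :=
  fun _ _ => mul_zero _

/-- The scaling `m : ℝ × 𝔻^n(1) → 𝔻^n(1)`, dual to `ε_i ↦ t ε_i`, on maps from a probe. -/
def smulD {n : ℕ} {e : ThCart} (r : e ⟶ line) (d : e ⟶ D n) : e ⟶ D n :=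
  toD (fun i => fn r * dcoord d i) (isNil_dcoord d).mul_left

lemma smulD_comp {n : ℕ} {X Y : ThCart} (g : X ⟶ Y) (r : Y ⟶ line) (d : Y ⟶ D n) :
    smulD (g ≫ r) (g ≫ d) = g ≫ smulD r d := by
  refine hom_D_ext fun i => ?_
  rw [dcoord_comp, smulD, smulD, dcoord_toD, dcoord_toD, map_mul, fn_comp, dcoord_comp]

/-- The base point `* → 𝔻^n(1)`, dual to `ε_i ↦ 0`, as a map from any probe. -/
def basePoint (n : ℕ) (e : ThCart) : e ⟶ D n := toD (fun _ => 0) isNil_zero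

lemma comp_basePoint {n : ℕ} {X Y : ThCart} (g : X ⟶ Y) :
    g ≫ basePoint n Y = basePoint n X := by
  refine hom_D_ext fun i => ?_
  rw [dcoord_comp, basePoint, basePoint, dcoord_toD, dcoord_toD, map_zero]

lemma smulD_basePoint {n : ℕ} {e : ThCart} (r : e ⟶ line) :
    smulD r (basePoint n e) = basePoint n e := by
  refine hom_D_ext fun i => ?_
  rw [smulD, basePoint, dcoord_toD, dcoord_toD, mul_zero]

lemma isNil_axis (n : ℕ) (i : Fin n) :
    IsNil (fun j : Fin n => if j = i then eps 1 0 else 0) := fun j k => by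
  have := isNil_eps 1 0 0
  dsimp only
  split_ifs <;> simp [this]

/-- The inclusion `𝔻^1(1) → 𝔻^n(1)` of the `i`-th axis, dual to `ε_i ↦ ε`, `ε_j ↦ 0` for
`j ≠ i`. -/
def axis (n : ℕ) (i : Fin n) : D 1 ⟶ D n :=
  toD (fun j => if j = i then eps 1 0 else 0) (isNil_axis n i)

lemma basePoint_axis {n : ℕ} (i : Fin n) (e : ThCart) :
    basePoint 1 e ≫ axis n i = basePoint n e := by
  refine hom_D_ext fun j => ?_
  rw [dcoord_comp, axis, dcoord_toD, basePoint, basePoint, dcoord_toD]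
  split_ifs
  · exact dcoord_toD _ _ _
  · exact map_zero _

lemma isNil_diag : IsNil (fun _ : Fin 2 => eps 1 0) := fun _ _ => isNil_eps 1 0 0

/-- The diagonal `𝔻^1(1) → 𝔻^2(1)`, dual to `ε_1 ↦ ε`, `ε_2 ↦ ε`. -/
def diag : D 1 ⟶ D 2 := toD (fun _ => eps 1 0) isNil_diag

/-! ### Mapping spaces and the synthetic tangent bundle -/

/-- The mapping space `[G, H]`, with plots `[G, H](e) = Hom(y(e) × G, H)`. -/
@[simps]
def mapSpace (G H : PSh) : PSh where
  obj e := yoneda.obj e.unop ⊗ G ⟶ H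
  map g := ↾fun v => (yoneda.map g.unop ▷ G) ≫ v

/-- The mapping space is functorial in the target, by postcomposition. -/
@[simps]
def mapSpacePost (G : PSh) {H H' : PSh} (f : H ⟶ H') : mapSpace G H ⟶ mapSpace G H' where
  app _ := ↾fun v => v ≫ f

/-- Restriction `[𝔻^n(1), F] → [𝔻^m(1), F]` along a map `𝔻^m(1) → 𝔻^n(1)`. -/
def restrict {m n : ℕ} (g : D m ⟶ D n) {F : PSh} {e : ThCart}
    (z : (mapSpace (yoneda.obj (D n)) F).obj (op e)) :
    (mapSpace (yoneda.obj (D m)) F).obj (op e) :=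
  (yoneda.obj e ◁ yoneda.map g) ≫ z

/-- The projection `[𝔻^n(1), F] → [*, F] ≅ F` given by the base point. -/
def proj {n : ℕ} {F : PSh} {e : ThCart} (z : (mapSpace (yoneda.obj (D n)) F).obj (op e)) :
    F.obj (op e) :=
  z.app (op e) (𝟙 e, basePoint n e)

/-- The synthetic tangent bundle `TF = [𝔻^1(1), F]`. -/
abbrev tangent (F : PSh) : PSh := mapSpace (yoneda.obj (D 1)) F

/-- The differential `Tf : TF → TG` of a map `f : F → G`. -/
abbrev tangentMap {F G : PSh} (f : F ⟶ G) : tangent F ⟶ tangent G := mapSpacePost _ f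

/-- For a plot `r` of `ℝ`, the map `(a, d) ↦ (a, r(a) · d)` of `y(e) × 𝔻^1(1)`. -/
def scaleMap {e : ThCart} (r : e ⟶ line) :
    yoneda.obj e ⊗ yoneda.obj (D 1) ⟶ yoneda.obj e ⊗ yoneda.obj (D 1) where
  app _ := ↾fun p => (p.1, smulD (p.1 ≫ r) p.2)
  naturality X Y g := by
    ext p
    refine Prod.ext rfl ?_
    exact smulD_comp g.unop (Prod.fst p ≫ r) (Prod.snd p)

/-- The canonical scaling `ℝ × TF → TF` on plots, `(r · v)(d) = v(r · d)`. -/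
def scale {F : PSh} {e : ThCart} (r : e ⟶ line) (v : (tangent F).obj (op e)) :
    (tangent F).obj (op e) :=
  scaleMap r ≫ v

/-- `u` is the fibrewise sum of the tangent vectors `v` and `w`: some plot of `[𝔻^2(1), F]`
restricts to `v` and `w` along the two axes, and to `u` along the diagonal. -/
def IsTangentSum {F : PSh} {e : ThCart} (v w u : (tangent F).obj (op e)) : Prop :=
  ∃ z : (mapSpace (yoneda.obj (D 2)) F).obj (op e),
    restrict (axis 2 0) z = v ∧ restrict (axis 2 1) z = w ∧ restrict diag z = u

/-- `F` is infinitesimally linear: for every `n`, the cocone of the `n` axes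
`𝔻^1(1) → 𝔻^n(1)` over the base point becomes a limit cone `[𝔻^n(1), F] ≅ TF ×_F ⋯ ×_F TF`. -/
def IsInfinitesimallyLinear (F : PSh) : Prop :=
  ∀ (n : ℕ) (e : ThCart) (x : F.obj (op e)) (v : Fin n → (tangent F).obj (op e)),
    (∀ i, proj (v i) = x) →
      ∃! z : (mapSpace (yoneda.obj (D n)) F).obj (op e),
        proj z = x ∧ ∀ i, restrict (axis n i) z = v i

/-- On an infinitesimally linear `F`, fibrewise sums exist and are unique, so that `IsTangentSum` is
the graph of the addition `TF ×_F TF ≅ [𝔻^2(1), F] → TF`. -/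
lemma IsInfinitesimallyLinear.existsUnique_sum {F : PSh} (hF : IsInfinitesimallyLinear F)
    {e : ThCart} (v w : (tangent F).obj (op e)) (h : proj v = proj w) :
    ∃! u, IsTangentSum v w u := by
  obtain ⟨z, ⟨-, hz⟩, huniq⟩ := hF 2 e (proj v) ![v, w] (by
    intro i
    fin_cases i
    · rfl
    · exact h.symm)
  refine ⟨restrict diag z, ⟨z, hz 0, hz 1, rfl⟩, ?_⟩
  rintro u ⟨z', h0, h1, rfl⟩
  have hz' : z' = z := by
    refine huniq z' ⟨?_, ?_⟩
    · rw [← h0]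
      exact (congrArg (fun d => z'.app (op e) (𝟙 e, d)) (basePoint_axis 0 e)).symm
    · intro i
      fin_cases i
      · exact h0
      · exact h1
  rw [hz']

/-- The real line `ℝ = y(ℝ)` as a presheaf on thickened Cartesian spaces. -/
abbrev realLine : PSh := yoneda.obj line

/-- Homogeneity of a map `TF → ℝ` for the canonical scaling of `TF`. -/
def IsHomogeneous {F : PSh} (f : tangent F ⟶ realLine) : Prop :=
  ∀ (e : ThCart) (r : e ⟶ line) (v : (tangent F).obj (op e)),
    fn (f.app (op e) (scale r v)) = fn r * fn (f.app (op e) v)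

/-- Fibrewise `ℝ`-linear maps `TF → ℝ`: homogeneous and additive on plots. When `F` is
infinitesimally linear (for instance a thickened Cartesian space), `IsTangentSum` is the graph of
the addition `TF ×_F TF ≅ [𝔻^2(1), F] → TF`, the second map being restriction to the diagonal. -/
def IsFiberwiseLinear {F : PSh} (f : tangent F ⟶ realLine) : Prop :=
  IsHomogeneous f ∧
    ∀ (e : ThCart) (v w u : (tangent F).obj (op e)), IsTangentSum v w u →
      fn (f.app (op e) u) = fn (f.app (op e) v) + fn (f.app (op e) w)

lemma proj_map {n : ℕ} {F : PSh} {e e' : ThCart} (g : e' ⟶ e)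
    (z : (mapSpace (yoneda.obj (D n)) F).obj (op e)) :
    proj ((mapSpace (yoneda.obj (D n)) F).map g.op z) = F.map g.op (proj z) := by
  have h := NatTrans.naturality_apply z g.op
    ((𝟙 e, basePoint n e) : (yoneda.obj e ⊗ yoneda.obj (D n)).obj (op e))
  refine Eq.trans ?_ h
  change z.app (op e') (𝟙 e' ≫ g, basePoint n e') = z.app (op e') (g ≫ 𝟙 e, g ≫ basePoint n e)
  rw [comp_basePoint, Category.id_comp, Category.comp_id]

lemma proj_scale {F : PSh} {e : ThCart} (r : e ⟶ line) (v : (tangent F).obj (op e)) :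
    proj (scale r v) = proj v := by
  change v.app (op e) (𝟙 e, smulD (𝟙 e ≫ r) (basePoint 1 e)) = _
  rw [smulD_basePoint]
  rfl

/-- A fibrewise `ℝ`-linear structure on the tangent bundle `TF → F`: an addition
`TF ×_F TF → TF` over `F` which, together with the canonical scaling `ℝ × TF → TF`, satisfies the
axioms of a module over `ℝ`. (Since `(r s) · v = r · (s · v)` and `1 · v = v` hold for the scaling,
the axioms below make `0 · v` a zero and `(-1) · v` an inverse of `v`.) -/
structure FiberwiseLinearStructure (F : PSh) where
  add : ∀ {e : ThCart} (v w : (tangent F).obj (op e)), proj v = proj w → (tangent F).obj (op e)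
  proj_add : ∀ {e : ThCart} (v w : (tangent F).obj (op e)) (h : proj v = proj w),
    proj (add v w h) = proj v
  map_add : ∀ {e e' : ThCart} (g : e' ⟶ e) (v w : (tangent F).obj (op e)) (h : proj v = proj w),
    (tangent F).map g.op (add v w h) =
      add ((tangent F).map g.op v) ((tangent F).map g.op w) (by rw [proj_map, proj_map, h])
  add_comm : ∀ {e : ThCart} (v w : (tangent F).obj (op e)) (h : proj v = proj w),
    add v w h = add w v h.symm
  add_assoc : ∀ {e : ThCart} (u v w : (tangent F).obj (op e)) (h : proj u = proj v)
    (h' : proj v = proj w),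
    add (add u v h) w ((proj_add u v h).trans (h.trans h')) =
      add u (add v w h') (h.trans (proj_add v w h').symm)
  scale_add : ∀ {e : ThCart} (r : e ⟶ line) (v w : (tangent F).obj (op e)) (h : proj v = proj w),
    scale r (add v w h) = add (scale r v) (scale r w) (by rw [proj_scale, proj_scale, h])
  add_scale : ∀ {e : ThCart} (r s t : e ⟶ line) (v : (tangent F).obj (op e)),
    fn t = fn r + fn s →
      scale t v = add (scale r v) (scale s v) (by rw [proj_scale, proj_scale])

/-- Fibrewise linearity of a map `TF → ℝ` for a given fibrewise linear structure on `TF`. -/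
def FiberwiseLinearStructure.IsLinear {F : PSh} (S : FiberwiseLinearStructure F)
    (f : tangent F ⟶ realLine) : Prop :=
  IsHomogeneous f ∧
    ∀ (e : ThCart) (v w : (tangent F).obj (op e)) (h : proj v = proj w),
      fn (f.app (op e) (S.add v w h)) = fn (f.app (op e) v) + fn (f.app (op e) w)

/-! ### The moduli space of 1-forms -/

/-- The value `ℝ_{𝔻^1(1)}` of the right adjoint of the tangent functor, with `e`-plots all maps
`Te → ℝ`. -/
@[simps]
def realLineD : PSh where
  obj e := tangent (yoneda.obj e.unop) ⟶ realLine
  map g := ↾fun f => tangentMap (yoneda.map g.unop) ≫ f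

lemma IsFiberwiseLinear.comp_tangentMap {F G : PSh} {f : tangent G ⟶ realLine}
    (hf : IsFiberwiseLinear f) (p : F ⟶ G) : IsFiberwiseLinear (tangentMap p ≫ f) := by
  refine ⟨fun e r v => hf.1 e r (v ≫ p), ?_⟩
  rintro e v w u ⟨z, rfl, rfl, rfl⟩
  exact hf.2 e _ _ _ ⟨z ≫ p, rfl, rfl, rfl⟩

/-- The fully classifying moduli space `Ω̂¹` of 1-forms, as a subobject of `ℝ_{𝔻^1(1)}`: its
`e`-plots are the fibrewise linear maps `Te → ℝ`. -/
def omegaHat : Subfunctor realLineD where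
  obj e := {f : tangent (yoneda.obj e.unop) ⟶ realLine | IsFiberwiseLinear f}
  map g _ hf := IsFiberwiseLinear.comp_tangentMap hf (yoneda.map g.unop)

/-- The presheaf `Ω̂¹`. -/
abbrev OmegaHat : PSh := omegaHat.toFunctor

/-- The inclusion `Ω̂¹ → ℝ_{𝔻^1(1)}`. -/
abbrev omegaHatInclusion : OmegaHat ⟶ realLineD := omegaHat.ι

/-- The canonical comparison `Hom(TF, ℝ) → Hom(F, ℝ_{𝔻^1(1)})`, which sends `f` to the map
`p ↦ f ∘ Tp` on plots `p : y(e) → F`. -/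
def transpose {F : PSh} (f : tangent F ⟶ realLine) : F ⟶ realLineD where
  app _ := ↾fun p => tangentMap (yonedaEquiv.symm p) ≫ f
  naturality X Y g := by
    ext p
    change tangentMap (yonedaEquiv.symm (F.map g p)) ≫ f =
      tangentMap (yoneda.map g.unop) ≫ tangentMap (yonedaEquiv.symm p) ≫ f
    have h := yonedaEquiv_symm_naturality_left g.unop F p
    rw [Quiver.Hom.op_unop] at h
    rw [← h]
    rfl

end ThSm
end

noncomputable section

namespace ThSm

/-! ### Evaluation of functions on thickened Cartesian spaces at points -/

/-! Three facts carry the proof. Representability: Weil algebras are closed under tensor products,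
so `y(e) × 𝔻^n(1)` is represented by `prodD e n`, and an `e`-plot of `TF` is the same as an `e ×
𝔻^1(1)`-plot of `F` (`toPlot`). Every tangent vector is then the image of one universal tangent
vector under the differential of a plot (`eq_universalPlot`). A map `TF → ℝ` is therefore recovered
from its transpose by evaluating at the universal vector, which gives the bijection in (i).
Homogeneity implies additivity: a differentiable function that is homogeneous of degree one is its
own derivative at `0`, hence linear (`map_add_of_homogeneous`). Suppose `v`, `w` and their sum occur
at the parameters `(1,0)`, `(0,1)`, `(1,1)` of a plot over `ℝ^2` that is compatible with scaling.
Then every homogeneous map is additive on them (`IsHomogeneous.map_point_add`). Such plots exist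
both for sums defined through `𝔻^2(1)` and for any module structure extending the scaling, so all
notions of fibrewise linearity reduce to homogeneity. Homogeneity can be tested on plots
(`isHomogeneous_iff_toPlot`), which identifies the image in (ii). Sheaves: the sheaf conditions on
`ℝ`, `ℝ_{𝔻^1(1)}` and `Ω̂¹` are proved for the larger `openTopology`. Functions on `ℝ^k × 𝔻` are
smooth `𝒪(𝔻)`-valued functions of a point, so they glue and representables are sheaves. Since
multiplying by `𝔻^1(1)` adds no points, the tangent functor sends covering sieves to local
isomorphisms (`W_tangentMap_sieve`), and `ℝ_{𝔻^1(1)}` is a sheaf by transposition. `Ω̂¹` is a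
subsheaf because homogeneity is a local condition. -/

instance (D : InfPoint) : Module.Finite ℝ D.Fn := D.isWeil.finite

instance (D : InfPoint) : Nontrivial D.Fn := D.isWeil.nontrivial

lemma Smooth.ext {k : ℕ} {f g : Smooth k} (h : ∀ x, f.toFun x = g.toFun x) : f = g :=
  Subtype.ext (funext h)

/-- Evaluation of smooth functions at a point. -/
def evalPt {k : ℕ} (x : Eu k) : Smooth k →ₐ[ℝ] ℝ where
  toFun f := f.toFun x
  map_one' := rfl
  map_mul' _ _ := rfl
  map_zero' := rfl
  map_add' _ _ := rfl
  commutes' _ := rfl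

/-- Evaluation of functions on `ℝ^k × 𝔻` at a point of `ℝ^k`, with values in `𝒪(𝔻)`. -/
def evalAt (e : ThCart) (x : Eu e.dim) : e.Fn →ₐ[ℝ] e.inf.Fn :=
  Algebra.TensorProduct.lift (A := Smooth e.dim) (B := e.inf.Fn)
    ((Algebra.ofId ℝ e.inf.Fn).comp (evalPt x)) (AlgHom.id ℝ e.inf.Fn) (fun _ _ => Commute.all _ _)

lemma evalAt_tmul (e : ThCart) (x : Eu e.dim) (f : Smooth e.dim) (w : e.inf.Fn) :
    evalAt e x (e.tmul f w) = f.toFun x • w := by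
  refine (Algebra.TensorProduct.lift_tmul (A := Smooth e.dim) (B := e.inf.Fn) _ _
    (fun _ _ => Commute.all _ _) f w).trans ?_
  rw [Algebra.smul_def]
  rfl

lemma ThCart.induction_on {e : ThCart} {p : e.Fn → Prop} (a : e.Fn) (h0 : p 0)
    (ht : ∀ f w, p (e.tmul f w)) (ha : ∀ a b, p a → p b → p (a + b)) : p a :=
  TensorProduct.induction_on (motive := p) a h0 ht ha

/-- Finite dimensionality of `𝒪(𝔻)` turns a function on `ℝ^k × 𝔻` into a finite tuple of smooth
functions, which reduces smoothness and equality to coordinates. -/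
lemma ThCart.exists_eq_sum {ι : Type} [Fintype ι] {e : ThCart} (b : Module.Basis ι ℝ e.inf.Fn)
    (a : e.Fn) : ∃ f : ι → Smooth e.dim, a = ∑ i, e.tmul (f i) (b i) := by
  induction a using ThCart.induction_on with
  | h0 => exact ⟨0, (Finset.sum_eq_zero fun i _ => TensorProduct.zero_tmul _ _).symm⟩
  | ht f w =>
    refine ⟨fun i => b.repr w i • f, ?_⟩
    conv_lhs => rw [← b.sum_repr w]
    refine (TensorProduct.tmul_sum _ _ _).trans (Finset.sum_congr rfl fun i _ => ?_)
    exact (TensorProduct.tmul_smul _ _ _).trans (TensorProduct.smul_tmul' _ _ _)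
  | ha a b ha hb =>
    obtain ⟨f, rfl⟩ := ha
    obtain ⟨g, rfl⟩ := hb
    refine ⟨f + g, ?_⟩
    rw [← Finset.sum_add_distrib]
    exact Finset.sum_congr rfl fun i _ => (TensorProduct.add_tmul _ _ _).symm

lemma evalAt_sum {ι : Type} [Fintype ι] {e : ThCart} (b : Module.Basis ι ℝ e.inf.Fn)
    (f : ι → Smooth e.dim) (x : Eu e.dim) :
    evalAt e x (∑ i, e.tmul (f i) (b i)) = ∑ i, (f i).toFun x • b i := by
  simp [map_sum, evalAt_tmul]

/-- A function on `ℝ^k × 𝔻` is determined by its values at the points of `ℝ^k`. -/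
lemma evalAt_ext {e : ThCart} {a a' : e.Fn} (h : ∀ x, evalAt e x a = evalAt e x a') : a = a' := by
  obtain ⟨f, rfl⟩ := ThCart.exists_eq_sum (Module.finBasis ℝ e.inf.Fn) a
  obtain ⟨g, rfl⟩ := ThCart.exists_eq_sum (Module.finBasis ℝ e.inf.Fn) a'
  have : f = g := by
    funext i
    refine Smooth.ext fun x => ?_
    have hx := h x
    rw [evalAt_sum, evalAt_sum] at hx
    have := congrArg (fun w => (Module.finBasis ℝ e.inf.Fn).repr w i) hx
    simpa only [Module.Basis.repr_sum_self] using this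
  rw [this]

lemma contDiff_evalAt {e : ThCart} (l : e.inf.Fn →ₗ[ℝ] ℝ) (a : e.Fn) :
    ContDiff ℝ ∞ (fun x => l (evalAt e x a)) := by
  obtain ⟨f, rfl⟩ := ThCart.exists_eq_sum (Module.finBasis ℝ e.inf.Fn) a
  have h : (fun x => l (evalAt e x (∑ i, e.tmul (f i) (Module.finBasis ℝ e.inf.Fn i)))) =
      fun x => ∑ i, (f i).toFun x • l (Module.finBasis ℝ e.inf.Fn i) := by
    funext x
    rw [evalAt_sum, map_sum]
    exact Finset.sum_congr rfl fun i _ => map_smul _ _ _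
  rw [h]
  exact ContDiff.sum fun i _ => ((f i).contDiff).smul contDiff_const

/-- A smooth family of elements of `𝒪(𝔻)` is a function on `ℝ^k × 𝔻`. -/
lemma exists_evalAt_eq {e : ThCart} (F : Eu e.dim → e.inf.Fn)
    (hF : ∀ l : e.inf.Fn →ₗ[ℝ] ℝ, ContDiff ℝ ∞ (fun x => l (F x))) :
    ∃ a : e.Fn, ∀ x, evalAt e x a = F x := by
  let b := Module.finBasis ℝ e.inf.Fn
  refine ⟨∑ i, e.tmul (Smooth.mk (fun x => b.coord i (F x)) (hF _)) (b i), fun x => ?_⟩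
  rw [evalAt_sum]
  exact b.sum_repr (F x)

/-! ### The reduced point of an infinitesimal point -/

/-- The decomposition `ℝ ⊕ V` with `V` nilpotent shows that the quotient by the nilradical is `ℝ`;
the residue is this quotient map. -/
lemma InfPoint.exists_residue (D : InfPoint) :
    ∃ ρ : D.Fn →ₐ[ℝ] ℝ, ∀ w, ρ w = 0 → IsNilpotent w := by
  obtain ⟨V, hV, hn⟩ : ∃ V : Submodule ℝ D.Fn, IsCompl (1 : Submodule ℝ D.Fn) V ∧
    ∀ v ∈ V, IsNilpotent v := D.isWeil.exists_compl
  have hb : Function.Bijective (Algebra.ofId ℝ (D.Fn ⧸ nilradical D.Fn)) := by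
    have : Nontrivial (D.Fn ⧸ nilradical D.Fn) := by
      refine Ideal.Quotient.nontrivial_iff.2 fun h => ?_
      have h1 : (1 : D.Fn) ∈ nilradical D.Fn := h ▸ Submodule.mem_top
      exact not_isNilpotent_one (mem_nilradical.1 h1)
    refine ⟨(Algebra.ofId ℝ (D.Fn ⧸ nilradical D.Fn)).toRingHom.injective, fun q => ?_⟩
    obtain ⟨w, rfl⟩ := Ideal.Quotient.mk_surjective q
    have hw : w ∈ (1 : Submodule ℝ D.Fn) ⊔ V := hV.sup_eq_top ▸ Submodule.mem_top
    obtain ⟨y, hy, v, hv, rfl⟩ := Submodule.mem_sup.1 hw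
    obtain ⟨r, rfl⟩ := Submodule.mem_one.1 hy
    refine ⟨r, ?_⟩
    rw [map_add, Ideal.Quotient.eq_zero_iff_mem.2 (mem_nilradical.2 (hn v hv)), add_zero]
    rfl
  let E := AlgEquiv.ofBijective _ hb
  refine ⟨(E.symm : _ →ₐ[ℝ] ℝ).comp (Ideal.Quotient.mkₐ ℝ (nilradical D.Fn)), fun w hw => ?_⟩
  have h1 : Ideal.Quotient.mkₐ ℝ (nilradical D.Fn) w = 0 := by
    have := congrArg E hw
    simpa using this
  exact mem_nilradical.1 (Ideal.Quotient.eq_zero_iff_mem.1 h1)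

/-- The inclusion of the reduced point `* → 𝔻`. -/
def InfPoint.residue (D : InfPoint) : D.Fn →ₐ[ℝ] ℝ := D.exists_residue.choose

lemma InfPoint.isNilpotent_of_residue {D : InfPoint} {w : D.Fn} (h : D.residue w = 0) :
    IsNilpotent w := D.exists_residue.choose_spec w h

/-- The value of a function on `ℝ^k × 𝔻` at a point of the underlying space `ℝ^k`. -/
def value (e : ThCart) (x : Eu e.dim) : e.Fn →ₐ[ℝ] ℝ := e.inf.residue.comp (evalAt e x)

lemma isNilpotent_of_value {e : ThCart} {a : e.Fn} (h : ∀ x, value e x a = 0) :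
    IsNilpotent a := by
  have : IsNoetherianRing e.inf.Fn := isNoetherian_of_tower ℝ inferInstance
  -- The exponent must not depend on the point: the nilradical of the Noetherian ring `𝒪(𝔻)` is a
  -- nilpotent ideal, so one `N` serves all `x`.
  obtain ⟨N, hN⟩ := IsNoetherianRing.isNilpotent_nilradical e.inf.Fn
  refine ⟨N, evalAt_ext fun x => ?_⟩
  rw [map_pow, map_zero]
  have hx : evalAt e x a ∈ nilradical e.inf.Fn :=
    mem_nilradical.2 (InfPoint.isNilpotent_of_residue (h x))
  have := Ideal.pow_mem_pow hx N
  rwa [hN] at this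

/-! ### The map of underlying spaces -/

/-- The inclusion of functions on `ℝ^k` into functions on `ℝ^k × 𝔻`. -/
def ThCart.incl (e : ThCart) : Smooth e.dim →ₐ[ℝ] e.Fn :=
  Algebra.TensorProduct.includeLeft (S := ℝ) (A := Smooth e.dim) (B := e.inf.Fn)

lemma ThCart.incl_apply (e : ThCart) (f : Smooth e.dim) : e.incl f = e.tmul f 1 := rfl

/-- The inclusion of functions on `𝔻` into functions on `ℝ^k × 𝔻`. -/
def ThCart.inclInf (e : ThCart) : e.inf.Fn →ₐ[ℝ] e.Fn :=
  Algebra.TensorProduct.includeRight (A := Smooth e.dim) (B := e.inf.Fn)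

lemma ThCart.hom_ext {X Y : ThCart} {f g : X ⟶ Y} (h : ∀ a, dual f (Y.incl a) = dual g (Y.incl a))
    (h' : ∀ w, dual f (Y.inclInf w) = dual g (Y.inclInf w)) : f = g :=
  Algebra.TensorProduct.ext (A := Smooth Y.dim) (B := Y.inf.Fn) (AlgHom.ext h) (AlgHom.ext h')

/-- The `i`-th coordinate function of `ℝ^k`. -/
def coordFn {k : ℕ} (i : Fin k) : Smooth k := Smooth.mk (fun x => x i) (by fun_prop)

lemma Smooth.isUnit {k : ℕ} {f : Smooth k} (hf : ∀ x, f.toFun x ≠ 0) : IsUnit f := by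
  refine isUnit_iff_exists_inv.2 ⟨Smooth.mk (fun x => (f.toFun x)⁻¹) (f.contDiff.inv hf), ?_⟩
  exact Smooth.ext fun x => mul_inv_cancel₀ (hf x)

/-- Every character of `C^∞(ℝ^k)` is the evaluation at a point. -/
lemma character_eq_evalPt {k : ℕ} (χ : Smooth k →ₐ[ℝ] ℝ) (f : Smooth k) :
    χ f = f.toFun (WithLp.toLp 2 fun i => χ (coordFn i)) := by
  by_contra hne
  set p : Eu k := WithLp.toLp 2 fun i => χ (coordFn i) with hp
  -- A sum of squares in the kernel of `χ`. It can vanish only at `p`, and only if `f p = χ f`;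
  -- otherwise it is a unit killed by `χ`, a contradiction.
  let g : Smooth k := (f - algebraMap ℝ _ (χ f)) ^ 2 +
    ∑ i, (coordFn i - algebraMap ℝ _ (χ (coordFn i))) ^ 2
  have hg : χ g = 0 := by simp [g]
  have hgx : ∀ x, g.toFun x = (f.toFun x - χ f) ^ 2 + ∑ i, (x i - χ (coordFn i)) ^ 2 := by
    intro x
    change evalPt x g = _
    simp only [g, map_add, map_pow, map_sub, map_sum, AlgHom.commutes]
    rfl
  have hu : IsUnit g := by
    refine Smooth.isUnit fun x hx => ?_
    rw [hgx] at hx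
    have hs : 0 ≤ ∑ i, (x i - χ (coordFn i)) ^ 2 := Finset.sum_nonneg fun i _ => sq_nonneg _
    have h1 : (f.toFun x - χ f) ^ 2 = 0 := by nlinarith [sq_nonneg (f.toFun x - χ f)]
    have h2 : ∑ i, (x i - χ (coordFn i)) ^ 2 = 0 := by linarith
    have hxp : x = p := by
      refine PiLp.ext fun i => ?_
      have := (Finset.sum_eq_zero_iff_of_nonneg fun i _ => sq_nonneg _).1 h2 i (Finset.mem_univ i)
      exact sub_eq_zero.1 (pow_eq_zero_iff two_ne_zero |>.1 this)
    rw [hxp] at h1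
    exact hne (sub_eq_zero.1 (pow_eq_zero_iff two_ne_zero |>.1 h1)).symm
  exact (hu.map χ).ne_zero hg

/-- The map `ℝ^k → ℝ^l` underlying a map `ℝ^k × 𝔻 → ℝ^l × 𝔻'`. -/
def underlying {X Y : ThCart} (φ : X ⟶ Y) (x : Eu X.dim) : Eu Y.dim :=
  WithLp.toLp 2 fun i => value X x (dual φ (Y.incl (coordFn i)))

lemma value_dual_incl {X Y : ThCart} (φ : X ⟶ Y) (x : Eu X.dim) (f : Smooth Y.dim) :
    value X x (dual φ (Y.incl f)) = f.toFun (underlying φ x) :=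
  character_eq_evalPt (((value X x).comp (dual φ)).comp Y.incl) f

lemma contDiff_underlying {X Y : ThCart} (φ : X ⟶ Y) : ContDiff ℝ ∞ (underlying φ) := by
  rw [contDiff_euclidean]
  exact fun i => contDiff_evalAt X.inf.residue.toLinearMap _

/-- The pullback of a function depends only on its germ along the image of the underlying map. -/
lemma dual_incl_congr {X Y : ThCart} (φ : X ⟶ Y) (χ f g : Smooth Y.dim)
    (hχ : ∀ x, χ.toFun (underlying φ x) = 1) (h : χ * f = χ * g) :
    dual φ (Y.incl f) = dual φ (Y.incl g) := by
  -- The pullback of `χ` differs from `1` by a nilpotent, so it is a unit and can be cancelled.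
  have hn : IsNilpotent (1 - dual φ (Y.incl χ)) := by
    refine isNilpotent_of_value fun x => ?_
    rw [map_sub, map_one, value_dual_incl, hχ, sub_self]
  have hu : IsUnit (dual φ (Y.incl χ)) := by
    have := hn.isUnit_one_sub
    rwa [sub_sub_cancel] at this
  refine hu.mul_left_cancel ?_
  rw [← map_mul, ← map_mul, ← map_mul, ← map_mul, h]

/-! ### Maps which do not change the infinitesimal thickening -/

/-- The map `g × id : ℝ^k × 𝔻 → ℝ^l × 𝔻`. -/
def prodId {k l : ℕ} (W : InfPoint) (g : Eu k → Eu l) (hg : ContDiff ℝ ∞ g) :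
    (⟨k, W⟩ : ThCart) ⟶ ⟨l, W⟩ :=
  ofDual (X := ⟨k, W⟩) (Y := ⟨l, W⟩)
    (Algebra.TensorProduct.map (pullback g hg) (AlgHom.id ℝ W.Fn))

lemma dual_prodId_tmul {k l : ℕ} (W : InfPoint) (g : Eu k → Eu l) (hg : ContDiff ℝ ∞ g)
    (f : Smooth l) (w : W.Fn) :
    dual (prodId W g hg) (ThCart.tmul ⟨l, W⟩ f w) = ThCart.tmul ⟨k, W⟩ (pullback g hg f) w :=
  Algebra.TensorProduct.map_tmul _ _ _ _

lemma evalAt_dual_prodId {k l : ℕ} (W : InfPoint) (g : Eu k → Eu l) (hg : ContDiff ℝ ∞ g)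
    (x : Eu k) (a : ThCart.Fn ⟨l, W⟩) :
    evalAt ⟨k, W⟩ x (dual (prodId W g hg) a) = evalAt ⟨l, W⟩ (g x) a := by
  induction a using ThCart.induction_on with
  | h0 => simp
  | ht f w =>
    rw [dual_prodId_tmul, evalAt_tmul, evalAt_tmul]
    rfl
  | ha a b ha hb => rw [map_add, map_add, map_add, ha, hb]

lemma ThCart.hom_ext_evalAt {X Y : ThCart} {f g : X ⟶ Y}
    (h : ∀ a x, evalAt X x (dual f a) = evalAt X x (dual g a)) : f = g :=
  AlgHom.ext fun a => evalAt_ext (h a)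

lemma prodId_comp {k l m : ℕ} (W : InfPoint) (g : Eu k → Eu l) (hg : ContDiff ℝ ∞ g)
    (h : Eu l → Eu m) (hh : ContDiff ℝ ∞ h) :
    prodId W g hg ≫ prodId W h hh = prodId W (h ∘ g) (hh.comp hg) := by
  refine ThCart.hom_ext_evalAt fun a x => ?_
  rw [dual_comp, evalAt_dual_prodId, evalAt_dual_prodId, evalAt_dual_prodId]
  rfl

lemma prodId_congr {k l : ℕ} (W : InfPoint) {g g' : Eu k → Eu l} (hg : ContDiff ℝ ∞ g)
    (hg' : ContDiff ℝ ∞ g') (h : g = g') : prodId W g hg = prodId W g' hg' := by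
  subst h
  rfl

lemma prodId_id (e : ThCart) : prodId e.inf (fun x : Eu e.dim => x) contDiff_id = 𝟙 e := by
  refine ThCart.hom_ext_evalAt fun a x => ?_
  exact evalAt_dual_prodId e.inf _ _ x a

lemma underlying_prodId_comp {k l : ℕ} (W : InfPoint) (g : Eu k → Eu l) (hg : ContDiff ℝ ∞ g)
    {Y : ThCart} (φ : (⟨l, W⟩ : ThCart) ⟶ Y) (x : Eu k) :
    underlying (prodId W g hg ≫ φ) x = underlying φ (g x) := by
  refine PiLp.ext fun i => ?_
  change value ⟨k, W⟩ x (dual (prodId W g hg) (dual φ (Y.incl (coordFn i)))) = _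
  rw [value, AlgHom.comp_apply, evalAt_dual_prodId]
  rfl

/-! ### Charts -/

/-- Supplies arbitrarily small charts around any point. -/
lemma isChart_univBall {k : ℕ} (x : Eu k) {s : ℝ} (hs : 0 < s) :
    IsChart (OpenPartialHomeomorph.univBall x s) (Metric.ball x s) := by
  have hsrc := OpenPartialHomeomorph.univBall_source x s
  have htgt := OpenPartialHomeomorph.univBall_target x hs
  refine ⟨Metric.isOpen_ball, OpenPartialHomeomorph.contDiff_univBall, ?_,
    (OpenPartialHomeomorph.univBall x s).symm, OpenPartialHomeomorph.contDiffOn_univBall_symm, ?_⟩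
  · rw [← htgt, ← (OpenPartialHomeomorph.univBall x s).image_source_eq_target, hsrc,
      Set.image_univ]
  · intro y
    exact (OpenPartialHomeomorph.univBall x s).left_inv (hsrc ▸ Set.mem_univ y)

lemma isChart_id (k : ℕ) : IsChart (fun x : Eu k => x) Set.univ :=
  ⟨isOpen_univ, contDiff_id, Set.range_id, fun x => x, contDiff_id.contDiffOn, fun _ => rfl⟩

/-- Charts compose, with inverse `h ∘ g`; this is what makes `openTopology` transitive. -/
lemma IsChart.image {k : ℕ} {j : Eu k → Eu k} {U : Set (Eu k)} (hj : IsChart j U)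
    {i : Eu k → Eu k} {V : Set (Eu k)} (hi : IsChart i V) : IsChart (j ∘ i) (j '' V) := by
  obtain ⟨hU, hjs, hjr, g, hg, hgj⟩ := hj
  obtain ⟨hV, his, hir, h, hh, hhi⟩ := hi
  have himg : j '' V = U ∩ g ⁻¹' V := by
    ext y
    constructor
    · rintro ⟨x, hx, rfl⟩
      refine ⟨hjr ▸ Set.mem_range_self x, ?_⟩
      rwa [Set.mem_preimage, hgj]
    · rintro ⟨hy, hyV⟩
      obtain ⟨x, rfl⟩ : y ∈ Set.range j := hjr.symm ▸ hy
      rw [Set.mem_preimage, hgj] at hyV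
      exact ⟨x, hyV, rfl⟩
  refine ⟨?_, hjs.comp his, by rw [Set.range_comp, hir], h ∘ g, ?_, fun x => ?_⟩
  · rw [himg]
    exact hg.continuousOn.isOpen_inter_preimage hU hV
  · rw [himg]
    exact hh.comp (hg.mono Set.inter_subset_left) fun y hy => hy.2
  · simp only [Function.comp_apply, hgj, hhi]

lemma contDiff_smul_of_tsupport_subset {E F : Type} [NormedAddCommGroup E] [NormedSpace ℝ E]
    [NormedAddCommGroup F] [NormedSpace ℝ F] {χ : E → ℝ} {g : E → F} {U : Set E} (hU : IsOpen U)
    (hχ : ContDiff ℝ ∞ χ) (hg : ContDiffOn ℝ ∞ g U) (h : tsupport χ ⊆ U) :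
    ContDiff ℝ ∞ (fun x => χ x • g x) := by
  rw [contDiff_iff_contDiffAt]
  intro x
  by_cases hx : x ∈ U
  · exact hχ.contDiffAt.smul (hg.contDiffAt (hU.mem_nhds hx))
  · have h0 : (fun x => χ x • g x) =ᶠ[nhds x] fun _ => 0 := by
      filter_upwards [notMem_tsupport_iff_eventuallyEq.1 fun hc => hx (h hc)] with y hy
      rw [hy, Pi.zero_apply, zero_smul]
    exact contDiffAt_const.congr_of_eventuallyEq h0

/-- A diffeomorphism onto an open set has, near each point of that set, an inverse which extends
smoothly to the whole space. -/
lemma IsChart.exists_local_inverse {k : ℕ} {j : Eu k → Eu k} {U : Set (Eu k)} (hj : IsChart j U)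
    {y : Eu k} (hy : y ∈ U) :
    ∃ (h : Eu k → Eu k) (χ : Eu k → ℝ) (r : ℝ), ContDiff ℝ ∞ h ∧ ContDiff ℝ ∞ χ ∧ 0 < r ∧
      (∀ z ∈ Metric.ball y r, χ z = 1) ∧ ∀ z, χ z ≠ 0 → j (h z) = z := by
  obtain ⟨hU, hjs, hjr, g, hg, hgj⟩ := hj
  obtain ⟨r, hr, hrU⟩ := Metric.nhds_basis_closedBall.mem_iff.1 (hU.mem_nhds hy)
  -- Nested cut-offs: `χ₁` has closed support inside `U`, so `χ₁ • g` is smooth everywhere, and `χ₁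
  -- = 1` wherever `χ₂ ≠ 0`, so there it is the true inverse of `j`.
  let χ₁ : ContDiffBump y := ⟨r / 2, r, by positivity, by linarith⟩
  let χ₂ : ContDiffBump y := ⟨r / 4, r / 2, by positivity, by linarith⟩
  refine ⟨fun z => χ₁ z • g z, χ₂, r / 4, ?_, χ₂.contDiff, by positivity, ?_, ?_⟩
  · exact contDiff_smul_of_tsupport_subset hU χ₁.contDiff hg (χ₁.tsupport_eq ▸ hrU)
  · exact fun z hz => χ₂.one_of_mem_closedBall (Metric.ball_subset_closedBall hz)
  · intro z hz
    have hz' : z ∈ Metric.ball y (r / 2) := χ₂.support_eq ▸ Function.mem_support.2 hz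
    have h1 : χ₁ z = 1 := χ₁.one_of_mem_closedBall (Metric.ball_subset_closedBall hz')
    have hzU : z ∈ U := hrU (Metric.closedBall_subset_closedBall (by linarith)
      (Metric.ball_subset_closedBall hz'))
    obtain ⟨u, rfl⟩ : z ∈ Set.range j := hjr.symm ▸ hzU
    simp only [h1, one_smul, hgj]

lemma evalAt_dual_thicken (e : ThCart) {j : Eu e.dim → Eu e.dim} (hj : ContDiff ℝ ∞ j)
    (x : Eu e.dim) (a : e.Fn) : evalAt e x (dual (thicken e j hj) a) = evalAt e (j x) a :=
  evalAt_dual_prodId e.inf j hj x a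

lemma thicken_comp (e : ThCart) {i j : Eu e.dim → Eu e.dim} (hi : ContDiff ℝ ∞ i)
    (hj : ContDiff ℝ ∞ j) :
    thicken e i hi ≫ thicken e j hj = thicken e (j ∘ i) (hj.comp hi) :=
  prodId_comp e.inf i hi j hj

lemma underlying_thicken_comp {e Y : ThCart} {i : Eu e.dim → Eu e.dim} (hi : ContDiff ℝ ∞ i)
    (φ : e ⟶ Y) (x : Eu e.dim) : underlying (thicken e i hi ≫ φ) x = underlying φ (i x) :=
  underlying_prodId_comp e.inf i hi φ x

/-- Locally, a map whose underlying map hits an open chart factors through this chart. -/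
lemma exists_factor {X Y : ThCart} (φ : X ⟶ Y) (x : Eu X.dim) {j : Eu Y.dim → Eu Y.dim}
    {U : Set (Eu Y.dim)} (hj : IsChart j U) (hx : underlying φ x ∈ U) :
    ∃ (i : Eu X.dim → Eu X.dim) (V : Set (Eu X.dim)) (hi : IsChart i V), x ∈ V ∧
      ∃ w : X ⟶ Y, thicken X i hi.2.1 ≫ φ = w ≫ thicken Y j hj.2.1 := by
  obtain ⟨h, χ, r, hh, hχ, hr, hχ1, hχj⟩ := hj.exists_local_inverse hx
  obtain ⟨s, hs, hsub⟩ := Metric.nhds_basis_ball.mem_iff.1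
    ((contDiff_underlying φ).continuous.continuousAt.preimage_mem_nhds
      (Metric.ball_mem_nhds (underlying φ x) hr))
  have hi := isChart_univBall x hs
  -- The factor is `φ`, restricted to a small ball, followed by the globally extended local inverse
  -- `h`. It remains to see that `j ∘ h` acts as the identity there.
  refine ⟨_, _, hi, Metric.mem_ball_self hs, (thicken X _ hi.2.1 ≫ φ) ≫ thicken Y h hh, ?_⟩
  rw [Category.assoc, thicken_comp]
  symm
  refine ThCart.hom_ext (fun f => ?_) (fun w => ?_)
  · rw [dual_comp]
    have h1 : dual (thicken Y (j ∘ h) (hj.2.1.comp hh)) (Y.incl f) =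
        Y.incl (pullback (j ∘ h) (hj.2.1.comp hh) f) :=
      dual_prodId_tmul Y.inf _ _ f 1
    rw [h1]
    -- `χ` is `1` along the image of the ball and `j ∘ h = id` wherever `χ ≠ 0`, so `f ∘ j ∘ h` and
    -- `f` have the same pullback, nilpotent directions included.
    refine dual_incl_congr _ (Smooth.mk χ hχ) _ _ (fun z => ?_) (Smooth.ext fun z => ?_)
    · rw [underlying_thicken_comp]
      refine hχ1 _ (hsub ?_)
      rw [← hi.2.2.1]
      exact Set.mem_range_self z
    · change χ z * f.toFun (j (h z)) = χ z * f.toFun z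
      by_cases hz : χ z = 0
      · rw [hz, zero_mul, zero_mul]
      · rw [hχj z hz]
  · rw [dual_comp]
    congr 1

/-! ### The topology of open covers -/

/-- The topology on thickened Cartesian spaces whose covering sieves are those containing an open
chart around each point. -/
def openTopology : GrothendieckTopology ThCart where
  sieves e := {S | ∀ x : Eu e.dim, ∃ (j : Eu e.dim → Eu e.dim) (U : Set (Eu e.dim))
    (hj : IsChart j U), x ∈ U ∧ S (thicken e j hj.2.1)}
  top_mem' e x := ⟨_, _, isChart_id _, Set.mem_univ x, trivial⟩
  pullback_stable' X Y S φ hS y := by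
    obtain ⟨j, U, hj, hx, hSj⟩ := hS (underlying φ y)
    obtain ⟨i, V, hi, hy, w, hw⟩ := exists_factor φ y hj hx
    refine ⟨i, V, hi, hy, ?_⟩
    change S (thicken Y i hi.2.1 ≫ φ)
    rw [hw]
    exact S.downward_closed hSj w
  transitive' X S hS R hR x := by
    obtain ⟨j, U, hj, hx, hSj⟩ := hS x
    obtain ⟨u, rfl⟩ : x ∈ Set.range j := hj.2.2.1.symm ▸ hx
    obtain ⟨i, V, hi, hu, hRi⟩ := hR hSj u
    refine ⟨_, _, hj.image hi, ⟨u, hu, rfl⟩, ?_⟩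
    have h : R (thicken X i hi.2.1 ≫ thicken X j hj.2.1) := hRi
    rwa [thicken_comp] at h

lemma mem_openTopology {e : ThCart} {S : Sieve e} :
    S ∈ openTopology e ↔ ∀ x : Eu e.dim, ∃ (j : Eu e.dim → Eu e.dim) (U : Set (Eu e.dim))
      (hj : IsChart j U), x ∈ U ∧ S (thicken e j hj.2.1) := Iff.rfl

/-- Sheaves for the topology of charts are therefore sheaves for good covers. The larger topology
has the advantage of an explicit description of its covering sieves. -/
lemma goodTopology_le_openTopology : goodTopology ≤ openTopology := by
  rw [goodTopology, Precoverage.toGrothendieck_eq_sInf]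
  refine sInf_le ?_
  rintro e _ ⟨𝒰, rfl⟩
  refine mem_openTopology.2 fun x => ?_
  obtain ⟨i, hi⟩ := Set.mem_iUnion.1 (𝒰.cover.symm ▸ Set.mem_univ x)
  exact ⟨_, _, 𝒰.isChart i, hi, ⟨_, 𝟙 _, _, Presieve.ofArrows.mk i,
    Category.id_comp _⟩⟩

/-! ### Gluing of functions -/

lemma fn_ext_of_charts {e : ThCart} {a b : e.Fn}
    (h : ∀ x : Eu e.dim, ∃ (j : Eu e.dim → Eu e.dim) (U : Set (Eu e.dim)) (hj : IsChart j U),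
      x ∈ U ∧ dual (thicken e j hj.2.1) a = dual (thicken e j hj.2.1) b) : a = b := by
  refine evalAt_ext fun x => ?_
  obtain ⟨j, U, hj, hx, hab⟩ := h x
  obtain ⟨u, rfl⟩ : x ∈ Set.range j := hj.2.2.1.symm ▸ hx
  rw [← evalAt_dual_thicken e hj.2.1, hab, evalAt_dual_thicken e hj.2.1]

/-- Functions on a thickened Cartesian space are determined on an open cover. -/
lemma fn_separated {e : ThCart} {S : Sieve e} (hS : S ∈ openTopology e) {a b : e.Fn}
    (h : ∀ (Y : ThCart) (s : Y ⟶ e), S s → dual s a = dual s b) : a = b := by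
  refine fn_ext_of_charts fun x => ?_
  obtain ⟨j, U, hj, hx, hSj⟩ := mem_openTopology.1 hS x
  exact ⟨j, U, hj, hx, h _ _ hSj⟩

/-- The inclusion `* × 𝔻 → ℝ^k × 𝔻` of a point. -/
def point (e : ThCart) (x : Eu e.dim) : (⟨0, e.inf⟩ : ThCart) ⟶ e :=
  prodId e.inf (fun _ => x) contDiff_const

lemma evalAt_dual_point (e : ThCart) (x : Eu e.dim) (y : Eu 0) (a : e.Fn) :
    evalAt ⟨0, e.inf⟩ y (dual (point e x) a) = evalAt e x a :=
  evalAt_dual_prodId e.inf (fun _ => x) contDiff_const y a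

lemma point_comp_thicken (e : ThCart) {j : Eu e.dim → Eu e.dim} (hj : ContDiff ℝ ∞ j)
    (x : Eu e.dim) : point e x ≫ thicken e j hj = point e (j x) :=
  prodId_comp e.inf (fun _ => x) contDiff_const j hj

/-- Functions on a thickened Cartesian space can be glued along an open cover. -/
lemma exists_glue {e : ThCart} {S : Sieve e} (hS : S ∈ openTopology e)
    (a : ∀ (Y : ThCart) (s : Y ⟶ e), S s → Y.Fn)
    (ha : ∀ (Y Z : ThCart) (s : Y ⟶ e) (hs : S s) (g : Z ⟶ Y),
      a Z (g ≫ s) (S.downward_closed hs g) = dual g (a Y s hs)) :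
    ∃ b : e.Fn, ∀ (Y : ThCart) (s : Y ⟶ e) (hs : S s), dual s b = a Y s hs := by
  have congr_a : ∀ {Y : ThCart} {s t : Y ⟶ e} (hs : S s) (ht : S t), s = t →
      a Y s hs = a Y t ht := by
    rintro Y s t hs ht rfl
    rfl
  have hpt : ∀ x, S (point e x) := fun x => by
    obtain ⟨j, U, hj, hx, hSj⟩ := mem_openTopology.1 hS x
    obtain ⟨u, rfl⟩ : x ∈ Set.range j := hj.2.2.1.symm ▸ hx
    rw [← point_comp_thicken e hj.2.1]
    exact S.downward_closed hSj _
  -- The glued function is prescribed pointwise: every `point e x` factors through a chart in `S`,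
  -- hence lies in `S`.
  let F : Eu e.dim → e.inf.Fn := fun x => evalAt ⟨0, e.inf⟩ 0 (a _ (point e x) (hpt x))
  have hF : ∀ (j : Eu e.dim → Eu e.dim) (hj : ContDiff ℝ ∞ j) (hSj : S (thicken e j hj)) u,
      F (j u) = evalAt e u (a _ _ hSj) := by
    intro j hj hSj u
    rw [← evalAt_dual_point e u 0, ← ha]
    exact congrArg _ (congr_a _ _ (point_comp_thicken e hj u).symm)
  obtain ⟨b, hb⟩ := exists_evalAt_eq (e := e) F fun l => by
    rw [contDiff_iff_contDiffAt]
    intro x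
    obtain ⟨j, U, hj, hx, hSj⟩ := mem_openTopology.1 hS x
    obtain ⟨hU, hjs, hjr, g, hg, hgj⟩ := id hj
    -- On the chart domain `U`, `F` is the given smooth section composed with the inverse `g` of the
    -- chart.
    have h1 : ContDiffOn ℝ ∞ (fun y => l (evalAt e (g y) (a _ _ hSj))) U :=
      (contDiff_evalAt l (a _ _ hSj)).comp_contDiffOn hg
    refine (h1.contDiffAt (hU.mem_nhds hx)).congr_of_eventuallyEq ?_
    filter_upwards [hU.mem_nhds hx] with y hy
    obtain ⟨u, rfl⟩ : y ∈ Set.range j := hjr.symm ▸ hy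
    rw [hF j hjs hSj, hgj]
  have hbj : ∀ (j : Eu e.dim → Eu e.dim) (hj : ContDiff ℝ ∞ j) (hSj : S (thicken e j hj)),
      dual (thicken e j hj) b = a _ _ hSj := fun j hj hSj =>
    evalAt_ext fun u => by rw [evalAt_dual_thicken, hb, hF j hj hSj]
  refine ⟨b, fun Y s hs => evalAt_ext fun y => ?_⟩
  -- A general member `s` of the sieve factors, locally on `Y`, through a chart in `S`, where the
  -- glued function is already known.
  obtain ⟨j, U, hj, hx, hSj⟩ := mem_openTopology.1 hS (underlying s y)
  obtain ⟨i, V, hi, hy, w, hw⟩ := exists_factor s y hj hx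
  obtain ⟨u, rfl⟩ : y ∈ Set.range i := hi.2.2.1.symm ▸ hy
  rw [← evalAt_dual_thicken Y hi.2.1, ← evalAt_dual_thicken Y hi.2.1]
  congr 1
  rw [← ha, ← dual_comp, congrArg (fun t => dual t b) hw, dual_comp, hbj j hj.2.1 hSj, ← ha]
  exact congr_a _ _ hw.symm

/-- Representable presheaves are sheaves for the topology of open covers. -/
lemma isSheaf_yoneda (X : ThCart) : Presheaf.IsSheaf openTopology (yoneda.obj X) := by
  rw [isSheaf_iff_isSheaf_of_type]
  intro e S hS x hx
  have hx' := (Presieve.compatible_iff_sieveCompatible x).1 hx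
  -- Glue the pullback of each function on `X` separately; uniqueness of gluing then forces the
  -- result to be an algebra map.
  choose b hb using fun c : X.Fn => exists_glue hS (fun Y s hs => dual (x s hs) c)
    (fun Y Z s hs g => by
      have h : x (g ≫ s) (S.downward_closed hs g) = g ≫ x s hs := hx' s g hs
      rw [h, dual_comp])
  let φ : X.Fn →ₐ[ℝ] e.Fn := {
    toFun := b
    map_one' := fn_separated hS fun Y s hs => by rw [hb _ Y s hs, map_one, map_one]
    map_zero' := fn_separated hS fun Y s hs => by rw [hb _ Y s hs, map_zero, map_zero]
    map_mul' c d := fn_separated hS fun Y s hs => by 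
      rw [hb _ Y s hs, map_mul, map_mul, hb _ Y s hs, hb _ Y s hs]
    map_add' c d := fn_separated hS fun Y s hs => by 
      rw [hb _ Y s hs, map_add, map_add, hb _ Y s hs, hb _ Y s hs]
    commutes' r := fn_separated hS fun Y s hs => by 
      rw [hb _ Y s hs, AlgHom.commutes, AlgHom.commutes] }
  refine ⟨ofDual φ, fun Y s hs => ?_, fun ψ hψ => ?_⟩
  · exact AlgHom.ext fun c => hb c Y s hs
  · refine AlgHom.ext fun c => fn_separated hS fun Y s hs => ?_
    have h : s ≫ ψ = x s hs := hψ s hs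
    refine Eq.trans ?_ (hb c Y s hs).symm
    rw [← h]
    rfl

/-! ### Products with first-order disks -/

/-- Converse of `InfPoint.exists_residue`: the kernel of the residue is the complement `V`. -/
lemma isWeilAlgebra_of_residue {W : Type} [CommRing W] [Algebra ℝ W] [Module.Finite ℝ W]
    (ρ : W →ₐ[ℝ] ℝ) (hρ : ∀ w, ρ w = 0 → IsNilpotent w) : IsWeilAlgebra W := by
  refine ⟨ρ.toRingHom.domain_nontrivial, inferInstance, LinearMap.ker ρ.toLinearMap,
    ⟨?_, ?_⟩, hρ⟩
  · rw [Submodule.disjoint_def]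
    intro x hx hxV
    obtain ⟨r, rfl⟩ := Submodule.mem_one.1 hx
    have h : ρ (algebraMap ℝ W r) = 0 := hxV
    rw [AlgHom.commutes] at h
    rw [show r = 0 from h, map_zero]
  · rw [codisjoint_iff, eq_top_iff]
    intro w _
    refine Submodule.mem_sup.2 ⟨algebraMap ℝ W (ρ w), Submodule.mem_one.2 ⟨_, rfl⟩,
      w - algebraMap ℝ W (ρ w), ?_, by ring⟩
    change ρ _ = 0
    rw [map_sub, AlgHom.commutes]
    exact sub_self _

lemma exists_infPoint_equiv {W : Type} [CommRing W] [Algebra ℝ W] [Module.Finite ℝ W]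
    (ρ : W →ₐ[ℝ] ℝ) (hρ : ∀ w, ρ w = 0 → IsNilpotent w) :
    ∃ Q : InfPoint, Nonempty (Q.Fn ≃ₐ[ℝ] W) := by
  obtain ⟨n, f, hf⟩ := Algebra.FiniteType.iff_quotient_mvPolynomial''.1
    (inferInstance : Algebra.FiniteType ℝ W)
  let θ := Ideal.quotientKerAlgEquivOfSurjective hf
  have : Module.Finite ℝ (MvPolynomial (Fin n) ℝ ⧸ RingHom.ker f) :=
    Module.Finite.equiv θ.symm.toLinearEquiv
  refine ⟨⟨n, RingHom.ker f, isWeilAlgebra_of_residue (ρ.comp (θ : _ →ₐ[ℝ] W)) fun w hw => ?_⟩,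
    ⟨θ⟩⟩
  have := (hρ _ hw).map θ.symm
  simpa using this

/-- On pure tensors, `w ⊗ w' - ρ(w)ρ(w')` splits as `(w - ρ(w)) ⊗ w' + ρ(w)(1 ⊗ (w' - ρ(w')))`, a
sum of commuting nilpotents. Hence the tensor product is again a Weil algebra. -/
lemma exists_tensor_residue (D D' : InfPoint) : ∃ ρ : D.Fn ⊗[ℝ] D'.Fn →ₐ[ℝ] ℝ,
    ∀ w, ρ w = 0 → IsNilpotent w := by
  let ρ : D.Fn ⊗[ℝ] D'.Fn →ₐ[ℝ] ℝ :=
    Algebra.TensorProduct.lift D.residue D'.residue (fun _ _ => Commute.all _ _)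
  have hD : ∀ (D : InfPoint) (w : D.Fn), IsNilpotent (w - algebraMap ℝ _ (D.residue w)) :=
    fun D w => InfPoint.isNilpotent_of_residue (by
      rw [map_sub, AlgHom.commutes]
      exact sub_self _)
  have key : ∀ a, IsNilpotent (a - algebraMap ℝ _ (ρ a)) := by
    intro a
    induction a using TensorProduct.induction_on with
    | zero => simp
    | tmul w w' =>
      have h : w ⊗ₜ[ℝ] w' - algebraMap ℝ _ (ρ (w ⊗ₜ w')) =
          Algebra.TensorProduct.includeLeft (S := ℝ) (w - algebraMap ℝ _ (D.residue w)) *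
            Algebra.TensorProduct.includeRight w' +
          algebraMap ℝ _ (D.residue w) * Algebra.TensorProduct.includeRight
            (w' - algebraMap ℝ _ (D'.residue w')) := by
        have h1 : ρ (w ⊗ₜ w') = D.residue w * D'.residue w' :=
          Algebra.TensorProduct.lift_tmul _ _ _ _ _
        have h2 : w ⊗ₜ[ℝ] w' = Algebra.TensorProduct.includeLeft (S := ℝ) w *
            Algebra.TensorProduct.includeRight w' := by simp
        rw [h1, h2, map_sub, map_sub, AlgHom.commutes, AlgHom.commutes, map_mul]
        ring
      rw [h]
      exact (Commute.all _ _).isNilpotent_add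
        ((Commute.all _ _).isNilpotent_mul_right ((hD D w).map _))
        ((Commute.all _ _).isNilpotent_mul_left ((hD D' w').map _))
    | add a b ha hb =>
      have h : a + b - algebraMap ℝ _ (ρ (a + b)) =
          (a - algebraMap ℝ _ (ρ a)) + (b - algebraMap ℝ _ (ρ b)) := by
        rw [map_add, map_add]
        ring
      rw [h]
      exact (Commute.all _ _).isNilpotent_add ha hb
  refine ⟨ρ, fun w hw => ?_⟩
  have := key w
  rwa [hw, map_zero, sub_zero] at this

lemma exists_prodInf (D D' : InfPoint) :
    ∃ Q : InfPoint, Nonempty (Q.Fn ≃ₐ[ℝ] D.Fn ⊗[ℝ] D'.Fn) := by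
  obtain ⟨ρ, hρ⟩ := exists_tensor_residue D D'
  exact exists_infPoint_equiv ρ hρ

/-- The product `𝔻 × 𝔻'` of infinitesimal points. -/
def prodInf (D D' : InfPoint) : InfPoint := (exists_prodInf D D').choose

/-- The isomorphism `𝒪(𝔻 × 𝔻') ≅ 𝒪(𝔻) ⊗ 𝒪(𝔻')`. -/
def prodInfEquiv (D D' : InfPoint) : (prodInf D D').Fn ≃ₐ[ℝ] D.Fn ⊗[ℝ] D'.Fn :=
  (exists_prodInf D D').choose_spec.some

/-- The product `e × 𝔻^n(1)`. -/
def prodD (e : ThCart) (n : ℕ) : ThCart := ⟨e.dim, prodInf e.inf (disk n 1)⟩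

/-- The pullback `𝒪(𝔻) → 𝒪(𝔻 × 𝔻')` along the first projection. -/
def prodInl (D D' : InfPoint) : D.Fn →ₐ[ℝ] (prodInf D D').Fn :=
  (prodInfEquiv D D').symm.toAlgHom.comp
    (Algebra.TensorProduct.includeLeft (R := ℝ) (S := ℝ) (A := D.Fn) (B := D'.Fn))

/-- The pullback `𝒪(𝔻') → 𝒪(𝔻 × 𝔻')` along the second projection. -/
def prodInr (D D' : InfPoint) : D'.Fn →ₐ[ℝ] (prodInf D D').Fn :=
  (prodInfEquiv D D').symm.toAlgHom.comp
    (Algebra.TensorProduct.includeRight (R := ℝ) (A := D.Fn) (B := D'.Fn))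

lemma prodInf_algHom_ext {D D' : InfPoint} {A : Type} [CommRing A] [Algebra ℝ A]
    {f g : (prodInf D D').Fn →ₐ[ℝ] A} (h : ∀ w, f (prodInl D D' w) = g (prodInl D D' w))
    (h' : ∀ w, f (prodInr D D' w) = g (prodInr D D' w)) : f = g := by
  have key : f.comp (prodInfEquiv D D').symm.toAlgHom =
      g.comp (prodInfEquiv D D').symm.toAlgHom :=
    Algebra.TensorProduct.ext (R := ℝ) (S := ℝ) (A := D.Fn) (B := D'.Fn)
      (AlgHom.ext h) (AlgHom.ext h')
  refine AlgHom.ext fun q => ?_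
  have := DFunLike.congr_fun key (prodInfEquiv D D' q)
  simpa using this

/-- The universal property of `𝒪(𝔻 × 𝔻')`. -/
def prodInfLift {D D' : InfPoint} {A : Type} [CommRing A] [Algebra ℝ A] (f : D.Fn →ₐ[ℝ] A)
    (g : D'.Fn →ₐ[ℝ] A) : (prodInf D D').Fn →ₐ[ℝ] A :=
  (Algebra.TensorProduct.lift f g (fun _ _ => Commute.all _ _)).comp
    (prodInfEquiv D D').toAlgHom

lemma prodInfLift_inl {D D' : InfPoint} {A : Type} [CommRing A] [Algebra ℝ A] (f : D.Fn →ₐ[ℝ] A)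
    (g : D'.Fn →ₐ[ℝ] A) (w : D.Fn) : prodInfLift f g (prodInl D D' w) = f w := by
  have h : prodInfEquiv D D' (prodInl D D' w) = w ⊗ₜ 1 :=
    (prodInfEquiv D D').apply_symm_apply _
  change Algebra.TensorProduct.lift f g (fun _ _ => Commute.all _ _) (prodInfEquiv D D' (prodInl D D' w)) = _
  rw [h, Algebra.TensorProduct.lift_tmul, map_one, mul_one]

lemma prodInfLift_inr {D D' : InfPoint} {A : Type} [CommRing A] [Algebra ℝ A] (f : D.Fn →ₐ[ℝ] A)
    (g : D'.Fn →ₐ[ℝ] A) (w : D'.Fn) : prodInfLift f g (prodInr D D' w) = g w := by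
  have h : prodInfEquiv D D' (prodInr D D' w) = 1 ⊗ₜ w :=
    (prodInfEquiv D D').apply_symm_apply _
  change Algebra.TensorProduct.lift f g (fun _ _ => Commute.all _ _) (prodInfEquiv D D' (prodInr D D' w)) = _
  rw [h, Algebra.TensorProduct.lift_tmul, map_one, one_mul]

/-- Functions on the infinitesimal part of `e × 𝔻^n(1)` pulled back from `e`. -/
def inlInf (e : ThCart) (n : ℕ) : e.inf.Fn →ₐ[ℝ] (prodD e n).inf.Fn :=
  prodInl e.inf (disk n 1)

/-- Functions on the infinitesimal part of `e × 𝔻^n(1)` pulled back from `𝔻^n(1)`. -/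
def inrInf (e : ThCart) (n : ℕ) : (disk n 1).Fn →ₐ[ℝ] (prodD e n).inf.Fn :=
  prodInr e.inf (disk n 1)

/-- The map `ℝ^k × 𝔻' → ℝ^k × 𝔻` induced by a map `𝔻' → 𝔻`. -/
def idProd {k : ℕ} {W W' : InfPoint} (h : W.Fn →ₐ[ℝ] W'.Fn) :
    (⟨k, W'⟩ : ThCart) ⟶ ⟨k, W⟩ :=
  ofDual (X := ⟨k, W'⟩) (Y := ⟨k, W⟩)
    (Algebra.TensorProduct.map (AlgHom.id ℝ (Smooth k)) h)

/-- The map `Y → ℝ^k × 𝔻` with given components. -/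
def homMk {k : ℕ} {W : InfPoint} {Y : ThCart} (f : Smooth k →ₐ[ℝ] Y.Fn) (g : W.Fn →ₐ[ℝ] Y.Fn) :
    Y ⟶ ⟨k, W⟩ :=
  ofDual (X := Y) (Y := ⟨k, W⟩)
    (Algebra.TensorProduct.lift (A := Smooth k) (B := W.Fn) f g (fun _ _ => Commute.all _ _))

lemma dual_homMk_tmul {k : ℕ} {W : InfPoint} {Y : ThCart} (f : Smooth k →ₐ[ℝ] Y.Fn)
    (g : W.Fn →ₐ[ℝ] Y.Fn) (a : Smooth k) (w : W.Fn) :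
    dual (homMk f g) (ThCart.tmul ⟨k, W⟩ a w) = f a * g w := rfl

/-- The projection `e × 𝔻^n(1) → e`. -/
def prodFst (e : ThCart) (n : ℕ) : prodD e n ⟶ e := idProd (prodInl e.inf (disk n 1))

lemma dual_prodFst_tmul (e : ThCart) (n : ℕ) (f : Smooth e.dim) (w : e.inf.Fn) :
    dual (prodFst e n) (e.tmul f w) = (prodD e n).tmul f (inlInf e n w) := rfl

lemma isNil_prodSnd (e : ThCart) (n : ℕ) : IsNil (fun i : Fin n =>
    (prodD e n).inclInf (inrInf e n ((disk n 1).quot (MvPolynomial.X i)))) := by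
  intro i j
  have h : (disk n 1).quot (MvPolynomial.X i) * (disk n 1).quot (MvPolynomial.X j) = 0 := by
    rw [← map_mul]
    refine Ideal.Quotient.eq_zero_iff_mem.2 ?_
    change _ ∈ (MvPolynomial.idealOfVars (Fin n) ℝ) ^ (1 + 1)
    rw [pow_succ, pow_one]
    exact Ideal.mul_mem_mul (Ideal.subset_span ⟨i, rfl⟩) (Ideal.subset_span ⟨j, rfl⟩)
  dsimp only
  rw [← map_mul, ← map_mul, h, map_zero, map_zero]

/-- The projection `e × 𝔻^n(1) → 𝔻^n(1)`. -/
def prodSnd (e : ThCart) (n : ℕ) : prodD e n ⟶ D n := toD _ (isNil_prodSnd e n)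

/-- The map `a → e × 𝔻^n(1)` with given components. -/
def prodPair {n : ℕ} {a e : ThCart} (g : a ⟶ e) (d : a ⟶ D n) : a ⟶ prodD e n :=
  homMk ((dual g).comp e.incl) (prodInfLift ((dual g).comp e.inclInf) ((dual d).comp (D n).inclInf))

lemma dual_prodPair_incl {n : ℕ} {a e : ThCart} (g : a ⟶ e) (d : a ⟶ D n) (f : Smooth e.dim) :
    dual (prodPair g d) ((prodD e n).incl f) = dual g (e.incl f) := by
  refine (dual_homMk_tmul _ _ f 1).trans ?_
  rw [map_one, mul_one]
  rfl

lemma dual_prodPair_inclInf {n : ℕ} {a e : ThCart} (g : a ⟶ e) (d : a ⟶ D n)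
    (q : (prodD e n).inf.Fn) : dual (prodPair g d) ((prodD e n).inclInf q) =
      prodInfLift ((dual g).comp e.inclInf) ((dual d).comp (D n).inclInf) q := by
  refine (dual_homMk_tmul _ _ 1 q).trans ?_
  rw [map_one, one_mul]
  rfl

lemma dual_prodPair_inlInf {n : ℕ} {a e : ThCart} (g : a ⟶ e) (d : a ⟶ D n) (w : e.inf.Fn) :
    dual (prodPair g d) ((prodD e n).inclInf (inlInf e n w)) = dual g (e.inclInf w) := by
  rw [dual_prodPair_inclInf]
  exact prodInfLift_inl _ _ w

lemma dual_prodPair_inrInf {n : ℕ} {a e : ThCart} (g : a ⟶ e) (d : a ⟶ D n)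
    (w : (disk n 1).Fn) :
    dual (prodPair g d) ((prodD e n).inclInf (inrInf e n w)) = dual d ((D n).inclInf w) := by
  rw [dual_prodPair_inclInf]
  exact prodInfLift_inr _ _ w

lemma dual_prodFst_incl (e : ThCart) (n : ℕ) (f : Smooth e.dim) :
    dual (prodFst e n) (e.incl f) = (prodD e n).incl f := by
  refine (dual_prodFst_tmul e n f 1).trans ?_
  rw [map_one]
  rfl

lemma dual_prodFst_inclInf (e : ThCart) (n : ℕ) (w : e.inf.Fn) :
    dual (prodFst e n) (e.inclInf w) = (prodD e n).inclInf (inlInf e n w) :=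
  dual_prodFst_tmul e n 1 w

lemma dcoord_prodSnd (e : ThCart) (n : ℕ) (i : Fin n) : dcoord (prodSnd e n) i =
    (prodD e n).inclInf (inrInf e n ((disk n 1).quot (MvPolynomial.X i))) :=
  dcoord_toD _ _ i

lemma prodPair_fst {n : ℕ} {a e : ThCart} (g : a ⟶ e) (d : a ⟶ D n) :
    prodPair g d ≫ prodFst e n = g := by
  refine ThCart.hom_ext (fun f => ?_) (fun w => ?_)
  · rw [dual_comp, dual_prodFst_incl, dual_prodPair_incl]
  · rw [dual_comp, dual_prodFst_inclInf, dual_prodPair_inlInf]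

lemma prodPair_snd {n : ℕ} {a e : ThCart} (g : a ⟶ e) (d : a ⟶ D n) :
    prodPair g d ≫ prodSnd e n = d := by
  refine hom_D_ext fun i => ?_
  rw [dcoord_comp, dcoord_prodSnd, dual_prodPair_inrInf]
  rfl

/-- Uniqueness in the universal property: functions on the product are generated by those of `e` and
the `ε_i`. Together with `prodPair` this makes `prodD e n` represent `y(e) × 𝔻^n(1)`. -/
lemma prodD_hom_ext {n : ℕ} {a e : ThCart} {f g : a ⟶ prodD e n}
    (h : f ≫ prodFst e n = g ≫ prodFst e n) (h' : f ≫ prodSnd e n = g ≫ prodSnd e n) :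
    f = g := by
  refine ThCart.hom_ext (fun b => ?_) (fun q => ?_)
  · have hb := congrArg (fun t => dual t (e.incl b)) h
    rw [dual_comp, dual_comp] at hb
    exact (congrArg (dual f) (dual_prodFst_incl e n b)).symm.trans
      (hb.trans (congrArg (dual g) (dual_prodFst_incl e n b)))
  · have key : (dual f).comp (prodD e n).inclInf = (dual g).comp (prodD e n).inclInf := by
      refine prodInf_algHom_ext (fun w => ?_) (fun w => ?_)
      · have hb := congrArg (fun t => dual t (e.inclInf w)) h
        simp only [dual_comp, dual_prodFst_inclInf] at hb
        exact hb
      · have hX : ((dual f).comp (prodD e n).inclInf).comp (inrInf e n) =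
            ((dual g).comp (prodD e n).inclInf).comp (inrInf e n) := by
          refine Ideal.Quotient.algHom_ext _ (MvPolynomial.algHom_ext fun i => ?_)
          have hb := congrArg (fun t => dcoord t i) h'
          simp only [dcoord_comp, dcoord_prodSnd] at hb
          exact hb
        exact DFunLike.congr_fun hX w
    exact DFunLike.congr_fun key q

lemma comp_prodPair {n : ℕ} {a b e : ThCart} (f : b ⟶ a) (g : a ⟶ e) (d : a ⟶ D n) :
    f ≫ prodPair g d = prodPair (f ≫ g) (f ≫ d) :=
  prodD_hom_ext (by rw [Category.assoc, prodPair_fst, prodPair_fst])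
    (by rw [Category.assoc, prodPair_snd, prodPair_snd])

lemma prodPair_eta {n : ℕ} (e : ThCart) : prodPair (prodFst e n) (prodSnd e n) = 𝟙 _ :=
  prodD_hom_ext (by rw [prodPair_fst, Category.id_comp]) (by rw [prodPair_snd, Category.id_comp])

/-- The map `g × id : e' × 𝔻^n(1) → e × 𝔻^n(1)`. -/
def prodMap {e' e : ThCart} (n : ℕ) (g : e' ⟶ e) : prodD e' n ⟶ prodD e n :=
  prodPair (prodFst e' n ≫ g) (prodSnd e' n)

/-- The factor `𝔻^n(1)` adds no points, so the charts of `e × 𝔻^n(1)` are products of charts of `e`;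
covers of the product thus come from covers of `e`. -/
lemma prodMap_thicken (e : ThCart) (n : ℕ) {j : Eu e.dim → Eu e.dim} (hj : ContDiff ℝ ∞ j) :
    prodMap n (thicken e j hj) = thicken (prodD e n) j hj := by
  have h1 : ∀ f : Smooth e.dim, dual (thicken e j hj) (e.incl f) = e.incl (pullback j hj f) :=
    fun f => dual_prodId_tmul e.inf j hj f 1
  have h2 : ∀ w, dual (thicken e j hj) (e.inclInf w) = e.inclInf w :=
    fun w => dual_prodId_tmul e.inf j hj 1 w
  have h1' : ∀ f : Smooth e.dim, dual (thicken (prodD e n) j hj) ((prodD e n).incl f) =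
      (prodD e n).incl (pullback j hj f) :=
    fun f => dual_prodId_tmul (prodD e n).inf j hj f 1
  have h2' : ∀ w, dual (thicken (prodD e n) j hj) ((prodD e n).inclInf w) =
      (prodD e n).inclInf w :=
    fun w => dual_prodId_tmul (prodD e n).inf j hj 1 w
  refine prodD_hom_ext ?_ ?_
  · rw [prodMap, prodPair_fst]
    refine ThCart.hom_ext (fun f => ?_) (fun w => ?_)
    · rw [dual_comp, dual_comp, h1, dual_prodFst_incl, dual_prodFst_incl, h1']
    · rw [dual_comp, dual_comp, h2, dual_prodFst_inclInf, h2']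
  · rw [prodMap, prodPair_snd]
    refine hom_D_ext fun i => ?_
    rw [dcoord_comp, dcoord_prodSnd, h2']

/-! ### Mapping spaces out of first-order disks as spaces of plots -/

lemma yonedaEquiv_symm_app {F : PSh} {e a : ThCart} (p : F.obj (op e)) (g : a ⟶ e) :
    (yonedaEquiv.symm p).app (op a) g = F.map g.op p := rfl

/-- The isomorphism `y(e) × 𝔻^n(1) → y(e × 𝔻^n(1))`, as a plot of `[𝔻^n(1), y(e × 𝔻^n(1))]`. -/
def universalPlot (e : ThCart) (n : ℕ) :
    (mapSpace (yoneda.obj (D n)) (yoneda.obj (prodD e n))).obj (op e) where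
  app _ := ↾fun p => prodPair p.1 p.2
  naturality X Y g := by
    ext p
    exact (comp_prodPair g.unop (Prod.fst p) (Prod.snd p)).symm

/-- The plot `e × 𝔻^n(1) → F` corresponding to a plot `e → [𝔻^n(1), F]`. -/
def toPlot {n : ℕ} {F : PSh} {e : ThCart} (z : (mapSpace (yoneda.obj (D n)) F).obj (op e)) :
    F.obj (op (prodD e n)) :=
  z.app (op (prodD e n)) (prodFst e n, prodSnd e n)

/-- Every pair `(g, d)` is the pullback of the universal pair of projections along `prodPair g d`,
so naturality determines `z` from `toPlot z`. -/
lemma app_eq_toPlot {n : ℕ} {F : PSh} {e : ThCart}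
    (z : (mapSpace (yoneda.obj (D n)) F).obj (op e)) {a : ThCart} (g : a ⟶ e) (d : a ⟶ D n) :
    z.app (op a) (g, d) = F.map (prodPair g d).op (toPlot z) := by
  have h := NatTrans.naturality_apply z (prodPair g d).op
    ((prodFst e n, prodSnd e n) : (yoneda.obj e ⊗ yoneda.obj (D n)).obj (op (prodD e n)))
  refine Eq.trans ?_ h
  change _ = z.app (op a) (prodPair g d ≫ prodFst e n, prodPair g d ≫ prodSnd e n)
  rw [prodPair_fst, prodPair_snd]

lemma mapSpace_ext {n : ℕ} {F : PSh} {e : ThCart}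
    {z z' : (mapSpace (yoneda.obj (D n)) F).obj (op e)} (h : toPlot z = toPlot z') : z = z' := by
  refine NatTrans.ext (funext fun a => ?_)
  ext ⟨g, d⟩
  exact (app_eq_toPlot z g d).trans ((congrArg _ h).trans (app_eq_toPlot z' g d).symm)

lemma toPlot_map {n : ℕ} {F : PSh} {e e' : ThCart} (g : e' ⟶ e)
    (z : (mapSpace (yoneda.obj (D n)) F).obj (op e)) :
    toPlot ((mapSpace (yoneda.obj (D n)) F).map g.op z) = F.map (prodMap n g).op (toPlot z) :=
  app_eq_toPlot z (prodFst e' n ≫ g) (prodSnd e' n)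

lemma toPlot_universalPlot (e : ThCart) (n : ℕ) :
    toPlot (universalPlot e n) = 𝟙 (prodD e n) := prodPair_eta e

/-- The Yoneda lemma for mapping spaces: any plot is the pushforward of the universal one along the
map classified by `toPlot z`. -/
lemma eq_universalPlot {n : ℕ} {F : PSh} {e : ThCart}
    (z : (mapSpace (yoneda.obj (D n)) F).obj (op e)) :
    z = (mapSpacePost _ (yonedaEquiv.symm (toPlot z))).app (op e) (universalPlot e n) := by
  refine mapSpace_ext ?_
  change _ = (yonedaEquiv.symm (toPlot z)).app (op (prodD e n)) (toPlot (universalPlot e n))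
  rw [toPlot_universalPlot, yonedaEquiv_symm_app, op_id, F.map_id]
  rfl

/-! ### The transposition `Hom(TF, ℝ) ≅ Hom(F, ℝ_{𝔻^1(1)})` -/

/-- Recovers `f` from its transpose; this gives injectivity and dictates the formula for
`untranspose`. -/
lemma app_eq_transpose {F : PSh} (f : tangent F ⟶ realLine) {e : ThCart}
    (v : (tangent F).obj (op e)) : f.app (op e) v =
      ((transpose f).app (op (prodD e 1)) (toPlot v) : tangent (yoneda.obj (prodD e 1)) ⟶
        realLine).app (op e) (universalPlot e 1) :=
  congrArg (f.app (op e)) (eq_universalPlot v)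

lemma transpose_injective (F : PSh) :
    Function.Injective (transpose : (tangent F ⟶ realLine) → (F ⟶ realLineD)) := by
  intro f f' h
  refine NatTrans.ext (funext fun e => ?_)
  ext v
  refine (app_eq_transpose (e := e.unop) f v).trans (Eq.trans ?_
    (app_eq_transpose (e := e.unop) f' v).symm)
  rw [h]

lemma tangentMap_universalPlot {e e' : ThCart} (g : e' ⟶ e) :
    (tangentMap (yoneda.map (prodMap 1 g))).app (op e') (universalPlot e' 1) =
      (tangent (yoneda.obj (prodD e 1))).map g.op (universalPlot e 1) := by
  refine mapSpace_ext ?_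
  rw [toPlot_map, toPlot_universalPlot]
  change toPlot (universalPlot e' 1) ≫ prodMap 1 g = prodMap 1 g ≫ 𝟙 _
  rw [toPlot_universalPlot, Category.id_comp, Category.comp_id]

/-- The inverse of the transposition. -/
def untranspose {F : PSh} (η : F ⟶ realLineD) : tangent F ⟶ realLine where
  app e := ↾fun v => (η.app (op (prodD e.unop 1)) (toPlot (e := e.unop) v) :
    tangent (yoneda.obj (prodD e.unop 1)) ⟶ realLine).app e (universalPlot e.unop 1)
  naturality X Y g := by
    ext v
    have h1 := toPlot_map g.unop (v : (tangent F).obj (op X.unop))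
    have h2 := NatTrans.naturality_apply η (prodMap 1 g.unop).op
      (toPlot (v : (tangent F).obj (op X.unop)))
    change (η.app (op (prodD Y.unop 1)) (toPlot ((tangent F).map g.unop.op v)) :
      tangent (yoneda.obj (prodD Y.unop 1)) ⟶ realLine).app Y (universalPlot Y.unop 1) = _
    rw [h1, h2]
    change (η.app (op (prodD X.unop 1)) (toPlot (v : (tangent F).obj (op X.unop))) :
      tangent (yoneda.obj (prodD X.unop 1)) ⟶ realLine).app Y
        ((tangentMap (yoneda.map (prodMap 1 g.unop))).app Y (universalPlot Y.unop 1)) = _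
    refine (congrArg _ (tangentMap_universalPlot g.unop)).trans ?_
    exact NatTrans.naturality_apply
      (η.app (op (prodD X.unop 1)) (toPlot (v : (tangent F).obj (op X.unop))) :
        tangent (yoneda.obj (prodD X.unop 1)) ⟶ realLine) g (universalPlot X.unop 1)

lemma transpose_untranspose {F : PSh} (η : F ⟶ realLineD) : transpose (untranspose η) = η := by
  refine NatTrans.ext (funext fun e₀ => ?_)
  ext p
  refine NatTrans.ext (funext fun e => ?_)
  ext v
  -- The plot of `Tp(v)` is `p` pulled back along the plot of `v`, so naturality of `η` moves that
  -- pullback outside; what remains is `eq_universalPlot` for `v`.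
  have hv : toPlot (e := e.unop) (n := 1) (F := F)
      ((tangentMap (yonedaEquiv.symm p)).app e v) =
        F.map (toPlot (e := e.unop) (n := 1) (F := yoneda.obj e₀.unop) v).op p :=
    rfl
  change (η.app (op (prodD e.unop 1)) (toPlot (e := e.unop) (n := 1) (F := F)
    ((tangentMap (yonedaEquiv.symm p)).app e v)) :
    tangent (yoneda.obj (prodD e.unop 1)) ⟶ realLine).app e (universalPlot e.unop 1) = _
  rw [hv, NatTrans.naturality_apply η]
  change (η.app e₀ p : tangent (yoneda.obj e₀.unop) ⟶ realLine).app e _ = _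
  refine congrArg ((η.app e₀ p : tangent (yoneda.obj e₀.unop) ⟶ realLine).app e) ?_
  refine Eq.trans ?_ (eq_universalPlot (e := e.unop) (n := 1) (F := yoneda.obj e₀.unop) v).symm
  refine congrArg (fun t => (tangentMap t).app e (universalPlot e.unop 1)) ?_
  refine NatTrans.ext (funext fun a => ?_)
  ext g
  rfl

lemma transpose_bijective (F : PSh) :
    Function.Bijective (transpose : (tangent F ⟶ realLine) → (F ⟶ realLineD)) :=
  ⟨transpose_injective F, fun η => ⟨untranspose η, transpose_untranspose η⟩⟩

/-! ### Sheaves -/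

/-- Mapping spaces are internal homs of presheaves. -/
def presheafHomIso (G H : PSh) : presheafHom G H ≅ mapSpace G H :=
  NatIso.ofComponents (fun e => Equiv.toIso
    { toFun α :=
        { app a := ↾fun p => α.app (op (Over.mk (show a.unop ⟶ e.unop from p.1))) p.2
          naturality a b g := by
            ext p
            exact NatTrans.naturality_apply α
              (Over.homMk g.unop : Over.mk (g.unop ≫ (show a.unop ⟶ e.unop from Prod.fst p)) ⟶
                Over.mk (show a.unop ⟶ e.unop from Prod.fst p)).op (Prod.snd p) }
      invFun φ :=
        { app Y := ↾fun d => φ.app (op Y.unop.left) (Y.unop.hom, d)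
          naturality Y Z g := by
            ext d
            refine Eq.trans ?_ (NatTrans.naturality_apply φ g.unop.left.op
              ((Y.unop.hom, d) : (yoneda.obj e.unop ⊗ G).obj (op Y.unop.left)))
            refine congrArg (fun t => φ.app (op Z.unop.left) (t, G.map g.unop.left.op d)) ?_
            exact (Over.w g.unop).symm }
      left_inv α := rfl
      right_inv φ := rfl })
    (fun g => rfl)

/-- Mapping spaces into sheaves are sheaves. -/
lemma isSheaf_mapSpace {J : GrothendieckTopology ThCart} (G : PSh) {H : PSh}
    (hH : Presheaf.IsSheaf J H) : Presheaf.IsSheaf J (mapSpace G H) :=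
  (Presheaf.isSheaf_of_iso_iff (presheafHomIso G H)).1 (Presheaf.IsSheaf.hom G H hH)

/-- All values of `v` factor through its plot, so `v` takes values in the sieve once the plot does.
-/
lemma exists_tangent_lift {e a : ThCart} (S : Sieve e) (v : (tangent (yoneda.obj e)).obj (op a))
    (hv : S (toPlot (n := 1) (F := yoneda.obj e) (e := a) v)) :
    ∃ t : (tangent S.functor).obj (op a), (tangentMap S.functorInclusion).app (op a) t = v := by
  have h : ∀ (b : ThCartᵒᵖ) (p : (yoneda.obj a ⊗ yoneda.obj (D 1)).obj b), S (v.app b p) := by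
    intro b p
    have hp : v.app b p = prodPair (Prod.fst p) (Prod.snd p) ≫
      (show prodD a 1 ⟶ e from toPlot (n := 1) (F := yoneda.obj e) (e := a) v) :=
      app_eq_toPlot (n := 1) (F := yoneda.obj e) (e := a) (a := b.unop) v (Prod.fst p) (Prod.snd p)
    rw [hp]
    exact S.downward_closed hv _
  refine ⟨{ app := fun b => ↾fun p => ⟨v.app b p, h b p⟩, naturality := fun b c g => ?_ }, rfl⟩
  ext p
  have h' := NatTrans.naturality_apply v g (show (yoneda.obj a ⊗ yoneda.obj (D 1)).obj b from p)
  exact Subtype.ext h'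

/-- Locally, the tangent vectors of `e` factor through a given open cover of `e`. -/
lemma exists_chart_toPlot {e a : ThCart} {S : Sieve e} (hS : S ∈ openTopology e)
    (v : (tangent (yoneda.obj e)).obj (op a)) (x : Eu a.dim) :
    ∃ (j : Eu a.dim → Eu a.dim) (U : Set (Eu a.dim)) (hj : IsChart j U), x ∈ U ∧
      S (toPlot (n := 1) (F := yoneda.obj e) (e := a)
        ((tangent (yoneda.obj e)).map (thicken a j hj.2.1).op v)) := by
  have h := openTopology.pullback_stable
    (toPlot (n := 1) (F := yoneda.obj e) (e := a) v) hS
  obtain ⟨j, U, hj, hx, hSj⟩ := mem_openTopology.1 h x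
  refine ⟨j, U, hj, hx, ?_⟩
  -- The cover of `a × 𝔻^1(1)` obtained by pulling back `S` contains a product chart `j × id`, that
  -- is, the restriction of `v` along `j` on `a`.
  have h1 : S (prodMap 1 (thicken a j hj.2.1) ≫
      (show prodD a 1 ⟶ e from toPlot (n := 1) (F := yoneda.obj e) (e := a) v)) := by
    have h2 := prodMap_thicken a 1 hj.2.1
    exact h2 ▸ hSj
  exact (congrArg (fun t : prodD a 1 ⟶ e => S t)
    (toPlot_map (n := 1) (F := yoneda.obj e) (thicken a j hj.2.1) v)).mpr h1

/-- The tangent functor sends covering sieves to local isomorphisms. -/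
lemma W_tangentMap_sieve {e : ThCart} {S : Sieve e} (hS : S ∈ openTopology e) :
    openTopology.W (tangentMap S.functorInclusion) := by
  rw [GrothendieckTopology.W_iff_isLocallyBijective]
  refine ⟨Presheaf.isLocallyInjective_of_injective _ _ fun X v w h => ?_, ⟨fun {a} v => ?_⟩⟩
  · refine NatTrans.ext (funext fun Y => ?_)
    ext p
    refine Subtype.ext ?_
    exact congrArg (fun t : (tangent (yoneda.obj e)).obj X => t.app Y p) h
  · refine mem_openTopology.2 fun x => ?_
    obtain ⟨j, U, hj, hx, hSj⟩ := exists_chart_toPlot hS v x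
    exact ⟨j, U, hj, hx, exists_tangent_lift S _ hSj⟩

lemma comp_transpose {F G : PSh} (i : F ⟶ G) (f : tangent G ⟶ realLine) :
    i ≫ transpose f = transpose (tangentMap i ≫ f) := by
  refine NatTrans.ext (funext fun e => ?_)
  ext p
  have h : yonedaEquiv.symm (i.app e p) = yonedaEquiv.symm p ≫ i := by
    refine NatTrans.ext (funext fun a => ?_)
    ext g
    exact (NatTrans.naturality_apply i g.op p).symm
  change tangentMap (yonedaEquiv.symm (i.app e p)) ≫ f = _
  rw [h]
  rfl

/-- Extending maps from a covering sieve `S` to `y(e)` transposes to extending maps to `ℝ` along `TS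
→ T y(e)`. The latter is a local isomorphism and `ℝ` is a sheaf. -/
lemma isSheaf_realLineD : Presheaf.IsSheaf openTopology realLineD := by
  rw [isSheaf_iff_isSheaf_of_type]
  refine Presieve.isSheaf_of_yoneda _ fun {e} S hS f => ?_
  obtain ⟨f', rfl⟩ := (transpose_bijective _).2 f
  obtain ⟨hinj, hsurj⟩ := W_tangentMap_sieve hS realLine (isSheaf_yoneda line)
  obtain ⟨f'', rfl⟩ := hsurj f'
  refine ⟨transpose f'', comp_transpose _ _, fun g hg => ?_⟩
  obtain ⟨g', rfl⟩ := (transpose_bijective _).2 g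
  refine congrArg transpose (hinj (transpose_injective _ ?_))
  exact (comp_transpose _ _).symm.trans hg

/-! ### Homogeneous maps on tangent bundles are fibrewise linear -/

/-- A differentiable function which is homogeneous of degree one is additive. -/
lemma map_add_of_homogeneous {E : Type} [NormedAddCommGroup E] [NormedSpace ℝ E] {g : E → ℝ}
    (hg : DifferentiableAt ℝ g 0) (h : ∀ (r : ℝ) (p : E), g (r • p) = r * g p) (p q : E) :
    g (p + q) = g p + g q := by
  -- Differentiate `g (r • p) = r * g p` at `r = 0` in two ways.
  have key : ∀ p, g p = fderiv ℝ g 0 p := by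
    intro p
    have h1 : HasDerivAt (fun r : ℝ => r • p) p 0 := by
      simpa using (hasDerivAt_id (0 : ℝ)).smul_const p
    have hg' : HasFDerivAt g (fderiv ℝ g 0) ((0 : ℝ) • p) := by
      rw [zero_smul]
      exact hg.hasFDerivAt
    have h2 : HasDerivAt (fun r : ℝ => g (r • p)) (fderiv ℝ g 0 p) 0 :=
      hg'.comp_hasDerivAt 0 h1
    have h3 : HasDerivAt (fun r : ℝ => g (r • p)) (g p) 0 := by
      simp only [h]
      simpa using (hasDerivAt_id (0 : ℝ)).mul_const (g p)
    exact h3.unique h2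
  rw [key, key p, key q, map_add]

/-- The map `e → ℝ` given by a smooth function. -/
def toLine (e : ThCart) (f : Smooth e.dim) : e ⟶ line :=
  homMk (e.incl.comp (pullback (fun x => WithLp.toLp 2 fun _ : Fin 1 => f.toFun x)
      ((contDiff_euclidean).2 fun _ => f.contDiff)))
    ((Algebra.ofId ℝ e.Fn).comp (disk 0 0).residue)

lemma fn_toLine (e : ThCart) (f : Smooth e.dim) : fn (toLine e f) = e.incl f := by
  refine (dual_homMk_tmul _ _ lineCoord 1).trans ?_
  rw [map_one, mul_one]
  rfl

/-- The constant map `e → ℝ`. -/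
def constLine (e : ThCart) (r : ℝ) : e ⟶ line := toLine e (algebraMap ℝ _ r)

lemma fn_constLine (e : ThCart) (r : ℝ) : fn (constLine e r) = algebraMap ℝ _ r := by
  rw [constLine, fn_toLine, AlgHom.commutes]

lemma dual_point_incl (e : ThCart) (x : Eu e.dim) (f : Smooth e.dim) :
    dual (point e x) (e.incl f) = algebraMap ℝ _ (f.toFun x) := by
  refine evalAt_ext fun y => ?_
  rw [evalAt_dual_point, ThCart.incl_apply, evalAt_tmul, AlgHom.commutes, Algebra.smul_def,
    mul_one]

lemma fn_ext_point {e : ThCart} {a b : e.Fn} (h : ∀ x, dual (point e x) a = dual (point e x) b) :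
    a = b :=
  evalAt_ext fun x => by rw [← evalAt_dual_point e x 0, h, evalAt_dual_point]

lemma fn_app_map {F : PSh} (f : F ⟶ realLine) {e e' : ThCart} (g : e' ⟶ e) (v : F.obj (op e)) :
    fn (f.app (op e') (F.map g.op v)) = dual g (fn (f.app (op e) v)) := by
  rw [NatTrans.naturality_apply]
  rfl

/-- A function on `ℝ^k × 𝔻` which is homogeneous of degree one on `ℝ^k` is additive on `ℝ^k`. -/
lemma dual_point_add {e : ThCart} {b : e.Fn} (hb : ∀ (r : ℝ) (p : Eu e.dim),
    dual (point e (r • p)) b = algebraMap ℝ _ r * dual (point e p) b) (p q : Eu e.dim) :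
    dual (point e (p + q)) b = dual (point e p) b + dual (point e q) b := by
  have hhom : ∀ (r : ℝ) (p : Eu e.dim), evalAt e (r • p) b = r • evalAt e p b := by
    intro r p
    have h := congrArg (evalAt ⟨0, e.inf⟩ 0) (hb r p)
    rw [evalAt_dual_point, map_mul, AlgHom.commutes, evalAt_dual_point] at h
    rw [h, Algebra.smul_def]
  refine evalAt_ext fun y => ?_
  rw [map_add]
  rw [evalAt_dual_point, evalAt_dual_point, evalAt_dual_point]
  refine (Module.finBasis ℝ e.inf.Fn).ext_elem fun i => ?_
  rw [map_add]
  exact map_add_of_homogeneous (g := fun x => (Module.finBasis ℝ e.inf.Fn).coord i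
    (evalAt e x b)) ((contDiff_evalAt _ b).differentiable (by simp) 0)
    (fun r p => by simp only [hhom, map_smul, smul_eq_mul]) p q

/-- The common core of both additivity statements: the family `u` is a single plot `z` over `ℝ^k ×
𝔻`, so `f` turns it into a function homogeneous in the `ℝ^k` variable, hence additive. -/
lemma IsHomogeneous.map_point_add {F : PSh} {f : tangent F ⟶ realLine} (hf : IsHomogeneous f)
    {e : ThCart} (z : (tangent F).obj (op e)) (u : Eu e.dim → (tangent F).obj (op ⟨0, e.inf⟩))
    (hu : ∀ p, (tangent F).map (point e p).op z = u p)
    (hr : ∀ (r : ℝ) (p : Eu e.dim), u (r • p) = scale (constLine _ r) (u p)) (p q : Eu e.dim) :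
    fn (f.app _ (u (p + q))) = fn (f.app _ (u p)) + fn (f.app _ (u q)) := by
  have h : ∀ p, fn (f.app _ (u p)) = dual (point e p) (fn (f.app _ z)) := fun p => by
    rw [← hu, fn_app_map]
  rw [h, h, h]
  refine dual_point_add (fun r p => ?_) p q
  rw [← h, ← h, hr, hf, fn_constLine]

lemma dcoord_smulD {n : ℕ} {e : ThCart} (r : e ⟶ line) (d : e ⟶ D n) (i : Fin n) :
    dcoord (smulD r d) i = fn r * dcoord d i := dcoord_toD _ _ i

lemma scale_congr {F : PSh} {e : ThCart} {r s : e ⟶ line} (h : fn r = fn s)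
    (v : (tangent F).obj (op e)) : scale r v = scale s v := by
  refine NatTrans.ext (funext fun a => ?_)
  ext p
  refine congrArg (fun d => v.app a (Prod.fst p, d)) (hom_D_ext fun i => ?_)
  have h' : fn ((Prod.fst p : a.unop ⟶ e) ≫ r) = fn ((Prod.fst p : a.unop ⟶ e) ≫ s) := by
    rw [fn_comp, fn_comp, h]
  exact (dcoord_smulD _ _ i).trans ((congrArg (· * _) h').trans (dcoord_smulD _ _ i).symm)

lemma map_scale {F : PSh} {e e' : ThCart} (g : e' ⟶ e) (r : e ⟶ line)
    (v : (tangent F).obj (op e)) :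
    (tangent F).map g.op (scale r v) = scale (g ≫ r) ((tangent F).map g.op v) := by
  refine NatTrans.ext (funext fun a => ?_)
  ext p
  refine congrArg (fun d => v.app a ((Prod.fst p : a.unop ⟶ e') ≫ g, d)) ?_
  change smulD (((Prod.fst p : a.unop ⟶ e') ≫ g) ≫ r) (Prod.snd p) =
    smulD ((Prod.fst p : a.unop ⟶ e') ≫ g ≫ r) (Prod.snd p)
  rw [Category.assoc]

lemma smulD_smulD {n : ℕ} {e : ThCart} {r s t : e ⟶ line} (h : fn t = fn r * fn s) (d : e ⟶ D n) :
    smulD s (smulD r d) = smulD t d := by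
  refine hom_D_ext fun i => ?_
  rw [dcoord_smulD, dcoord_smulD, dcoord_smulD, h]
  ring

lemma scale_scale {F : PSh} {e : ThCart} {r s t : e ⟶ line} (h : fn t = fn r * fn s)
    (v : (tangent F).obj (op e)) : scale r (scale s v) = scale t v := by
  refine NatTrans.ext (funext fun a => ?_)
  ext p
  refine congrArg (fun d => v.app a (Prod.fst p, d)) (smulD_smulD ?_ _)
  exact (congrArg (dual (Prod.fst p : a.unop ⟶ e)) h).trans (map_mul _ _ _)

lemma scale_one {F : PSh} {e : ThCart} {r : e ⟶ line} (h : fn r = 1)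
    (v : (tangent F).obj (op e)) : scale r v = v := by
  refine NatTrans.ext (funext fun a => ?_)
  ext p
  refine congrArg (fun d => v.app a (Prod.fst p, d)) (hom_D_ext fun i => ?_)
  refine (dcoord_smulD _ _ i).trans ?_
  have h' : fn ((Prod.fst p : a.unop ⟶ e) ≫ r) = 1 := by
    rw [fn_comp, h, map_one]
  exact (congrArg (· * _) h').trans (one_mul _)

/-- Scaling by zero sends every `d` to the base point, leaving the constant path at `proj v`. -/
lemma scale_zero {F : PSh} {e : ThCart} {r : e ⟶ line} (h : fn r = 0)
    {v w : (tangent F).obj (op e)} (hvw : proj v = proj w) : scale r v = scale r w := by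
  have key : ∀ (v : (tangent F).obj (op e)) (a : ThCart) (g : a ⟶ e) (d : a ⟶ D 1),
      (scale r v).app (op a) (g, d) = F.map g.op (proj v) := by
    intro v a g d
    have h1 : smulD (g ≫ r) d = g ≫ basePoint 1 e := by
      rw [comp_basePoint]
      refine hom_D_ext fun i => ?_
      rw [smulD, basePoint, dcoord_toD, dcoord_toD, fn_comp, h, map_zero, zero_mul]
    have h2 := NatTrans.naturality_apply v g.op
      ((𝟙 e, basePoint 1 e) : (yoneda.obj e ⊗ yoneda.obj (D 1)).obj (op e))
    refine Eq.trans ?_ h2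
    change v.app (op a) (g, smulD (g ≫ r) d) = v.app (op a) (g ≫ 𝟙 e, g ≫ basePoint 1 e)
    rw [h1, Category.comp_id]
  refine NatTrans.ext (funext fun a => ?_)
  ext p
  refine (key v a.unop (Prod.fst p) (Prod.snd p)).trans (Eq.trans ?_
    (key w a.unop (Prod.fst p) (Prod.snd p)).symm)
  rw [hvw]

/-! #### Tangent sums -/

lemma isNil_linD {n : ℕ} (p : Eu n) :
    IsNil (fun i => algebraMap ℝ (D 1).Fn (p i) * eps 1 0) := fun i j => by
  dsimp only
  rw [mul_mul_mul_comm, isNil_eps 1 0 0, mul_zero]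

/-- The line `𝔻^1(1) → 𝔻^n(1)` in a given direction. -/
def linD {n : ℕ} (p : Eu n) : D 1 ⟶ D n := toD _ (isNil_linD p)

lemma restrict_linD_smul {n : ℕ} {F : PSh} {e : ThCart} (r : ℝ) (p : Eu n)
    (z : (mapSpace (yoneda.obj (D n)) F).obj (op e)) :
    restrict (linD (r • p)) z = scale (constLine e r) (restrict (linD p) z) := by
  refine NatTrans.ext (funext fun a => ?_)
  ext q
  refine congrArg (fun d => z.app a (Prod.fst q, d)) ?_
  change (Prod.snd q : a.unop ⟶ D 1) ≫ linD (r • p) =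
    smulD ((Prod.fst q : a.unop ⟶ e) ≫ constLine e r) (Prod.snd q) ≫ linD p
  refine hom_D_ext fun i => ?_
  rw [dcoord_comp, dcoord_comp, linD, linD, dcoord_toD, dcoord_toD, map_mul, map_mul,
    AlgHom.commutes, AlgHom.commutes]
  change _ * dcoord (Prod.snd q : a.unop ⟶ D 1) 0 = _ * dcoord (smulD _ _) 0
  rw [dcoord_smulD, fn_comp, fn_constLine, AlgHom.commutes, PiLp.smul_apply, smul_eq_mul,
    map_mul]
  ring

lemma isNil_genericLine {a e : ThCart} (g : a ⟶ e) (d : a ⟶ D 1) :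
    IsNil (fun i : Fin e.dim => dual g (e.incl (coordFn i)) * dcoord d 0) := fun i j => by
  dsimp only
  rw [mul_mul_mul_comm, isNil_dcoord d 0 0, mul_zero]

/-- The map `ℝ^n × 𝔻 × 𝔻^1(1) → 𝔻^n(1)`, `(p, w, d) ↦ d p`, on maps from a probe. -/
def genericLine {a e : ThCart} (g : a ⟶ e) (d : a ⟶ D 1) : a ⟶ D e.dim :=
  toD _ (isNil_genericLine g d)

lemma dcoord_genericLine {a e : ThCart} (g : a ⟶ e) (d : a ⟶ D 1) (i : Fin e.dim) :
    dcoord (genericLine g d) i = dual g (e.incl (coordFn i)) * dcoord d 0 := dcoord_toD _ _ i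

lemma comp_genericLine {a b e : ThCart} (h : b ⟶ a) (g : a ⟶ e) (d : a ⟶ D 1) :
    genericLine (h ≫ g) (h ≫ d) = h ≫ genericLine g d := by
  refine hom_D_ext fun i => ?_
  rw [dcoord_comp, dcoord_genericLine, dcoord_genericLine, map_mul]
  rfl

/-- The projection `ℝ^k × 𝔻 → 𝔻`. -/
def toInf (e : ThCart) : e ⟶ ⟨0, e.inf⟩ := prodId e.inf (fun _ => 0) contDiff_const

lemma point_comp_toInf (e : ThCart) (x : Eu e.dim) : point e x ≫ toInf e = 𝟙 _ := by
  rw [← prodId_id ⟨0, e.inf⟩]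
  refine (prodId_comp e.inf _ contDiff_const _ contDiff_const).trans ?_
  exact prodId_congr _ _ _ (funext fun y => Subsingleton.elim _ _)

/-- The map `ℝ^n × 𝔻 × 𝔻^1(1) → 𝔻 × 𝔻^n(1)`, `(p, w, d) ↦ (w, d p)`. -/
def lineMap (e : ThCart) : yoneda.obj e ⊗ yoneda.obj (D 1) ⟶
    yoneda.obj (⟨0, e.inf⟩ : ThCart) ⊗ yoneda.obj (D e.dim) where
  app a := ↾fun p => (CategoryStruct.comp (Z := (⟨0, e.inf⟩ : ThCart)) p.1 (toInf e),
    genericLine p.1 p.2)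
  naturality X Y g := by
    ext p
    exact Prod.ext (Category.assoc g.unop (Prod.fst p) (toInf e))
      (comp_genericLine g.unop (Prod.fst p) (Prod.snd p))

/-- Restrictions of `z` to all lines through the base point of `𝔻^n(1)` are the fibres of one plot
over `ℝ^n × 𝔻`, the smooth family that `IsHomogeneous.map_point_add` requires. -/
lemma map_point_lineMap {F : PSh} (e : ThCart) (p : Eu e.dim)
    (z : (mapSpace (yoneda.obj (D e.dim)) F).obj (op ⟨0, e.inf⟩)) :
    (tangent F).map (point e p).op (lineMap e ≫ z : yoneda.obj e ⊗ yoneda.obj (D 1) ⟶ F) =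
      restrict (linD p) z := by
  refine NatTrans.ext (funext fun a => ?_)
  ext q
  have key : ∀ (g : a.unop ⟶ (⟨0, e.inf⟩ : ThCart)) (d : a.unop ⟶ D 1),
      (((g ≫ point e p) ≫ toInf e, genericLine (g ≫ point e p) d) :
        (yoneda.obj (⟨0, e.inf⟩ : ThCart) ⊗ yoneda.obj (D e.dim)).obj a) = (g, d ≫ linD p) := by
    intro g d
    refine Prod.ext ?_ (hom_D_ext fun i => ?_)
    · change (g ≫ point e p) ≫ toInf e = g
      rw [Category.assoc, point_comp_toInf, Category.comp_id]
    · change dcoord (genericLine (g ≫ point e p) d) i = dcoord (d ≫ linD p) i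
      rw [dcoord_genericLine, dcoord_comp, linD, dcoord_toD, dual_comp, dual_point_incl, map_mul,
        AlgHom.commutes, AlgHom.commutes]
      rfl
  exact congrArg (z.app a) (key (Prod.fst q) (Prod.snd q))

/-- The `i`-th unit vector of `ℝ^2`. -/
def unitVec (i : Fin 2) : Eu 2 := WithLp.toLp 2 fun j => if j = i then 1 else 0

lemma unitVec_apply (i j : Fin 2) : unitVec i j = if j = i then 1 else 0 := rfl

lemma unitVec_add_apply (j : Fin 2) : (unitVec 0 + unitVec 1) j = 1 := by
  rw [PiLp.add_apply, unitVec_apply, unitVec_apply]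
  fin_cases j <;> simp

lemma linD_unitVec (i : Fin 2) : linD (unitVec i) = axis 2 i := by
  refine hom_D_ext fun j => ?_
  rw [linD, axis, dcoord_toD, dcoord_toD, unitVec_apply]
  split_ifs <;> simp

lemma linD_unitVec_add : linD (unitVec 0 + unitVec 1) = diag := by
  refine hom_D_ext fun j => ?_
  rw [linD, diag, dcoord_toD, dcoord_toD, unitVec_add_apply, map_one, one_mul]

lemma map_restrict {m n : ℕ} (h : D m ⟶ D n) {F : PSh} {e e' : ThCart} (g : e' ⟶ e)
    (z : (mapSpace (yoneda.obj (D n)) F).obj (op e)) :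
    (mapSpace (yoneda.obj (D m)) F).map g.op (restrict h z) =
      restrict h ((mapSpace (yoneda.obj (D n)) F).map g.op z) := rfl

/-- Homogeneous maps `TF → ℝ` preserve tangent sums. -/
lemma IsHomogeneous.isFiberwiseLinear {F : PSh} {f : tangent F ⟶ realLine}
    (hf : IsHomogeneous f) : IsFiberwiseLinear f := by
  refine ⟨hf, ?_⟩
  rintro e v w u ⟨z, rfl, rfl, rfl⟩
  refine fn_ext_point fun x => ?_
  rw [map_add, ← fn_app_map, ← fn_app_map, ← fn_app_map, map_restrict, map_restrict, map_restrict,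
    ← linD_unitVec, ← linD_unitVec, ← linD_unitVec_add]
  -- Over a point of `e` only `e.inf` remains as base, and `ℝ^2` is free to serve as the space of
  -- directions in `𝔻^2(1)`; the axes are its unit vectors and the diagonal is their sum.
  exact hf.map_point_add (e := ⟨2, e.inf⟩) _
    (fun p => restrict (linD p) ((mapSpace (yoneda.obj (D 2)) F).map (point e x).op z))
    (fun p => map_point_lineMap ⟨2, e.inf⟩ p _) (fun r p => restrict_linD_smul r p _) _ _

lemma FiberwiseLinearStructure.add_congr {F : PSh} (S : FiberwiseLinearStructure F) {e : ThCart}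
    {v v' w w' : (tangent F).obj (op e)} (hv : v = v') (hw : w = w') (h : proj v = proj w) :
    S.add v w h = S.add v' w' (by rw [← hv, ← hw, h]) := by
  subst hv hw
  rfl

/-- `1 · v + 0 · w = 1 · v + 0 · v = (1 + 0) · v`, as `0 · w` depends only on the base point. -/
lemma FiberwiseLinearStructure.add_scale_zero {F : PSh} (S : FiberwiseLinearStructure F)
    {e : ThCart} {r s : e ⟶ line} (hr : fn r = 1) (hs : fn s = 0)
    {v w : (tangent F).obj (op e)} (h : proj v = proj w)
    (h' : proj (scale r v) = proj (scale s w)) : S.add (scale r v) (scale s w) h' = v := by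
  rw [S.add_congr rfl (scale_zero hs h.symm) h']
  rw [← S.add_scale r s r v (by rw [hs, add_zero]), scale_one hr]

/-- The combination `p₀ v + p₁ w` of tangent vectors. -/
def FiberwiseLinearStructure.comb {F : PSh} (S : FiberwiseLinearStructure F) {e : ThCart}
    (v w : (tangent F).obj (op e)) (h : proj v = proj w) (p : Eu 2) : (tangent F).obj (op e) :=
  S.add (scale (constLine e (p 0)) v) (scale (constLine e (p 1)) w)
    (by rw [proj_scale, proj_scale, h])

lemma FiberwiseLinearStructure.comb_smul {F : PSh} (S : FiberwiseLinearStructure F) {e : ThCart}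
    (v w : (tangent F).obj (op e)) (h : proj v = proj w) (r : ℝ) (p : Eu 2) :
    S.comb v w h (r • p) = scale (constLine e r) (S.comb v w h p) := by
  have hs : ∀ i, fn (constLine e ((r • p) i)) = fn (constLine e r) * fn (constLine e (p i)) := by
    intro i
    rw [fn_constLine, fn_constLine, fn_constLine, PiLp.smul_apply, smul_eq_mul, map_mul]
  rw [comb, comb, S.scale_add]
  exact S.add_congr (scale_scale (hs 0) v).symm (scale_scale (hs 1) w).symm _

lemma FiberwiseLinearStructure.comb_unitVec_zero {F : PSh} (S : FiberwiseLinearStructure F)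
    {e : ThCart} (v w : (tangent F).obj (op e)) (h : proj v = proj w) :
    S.comb v w h (unitVec 0) = v :=
  S.add_scale_zero (by rw [fn_constLine, unitVec_apply]; simp)
    (by rw [fn_constLine, unitVec_apply]; simp) h _

lemma FiberwiseLinearStructure.comb_unitVec_one {F : PSh} (S : FiberwiseLinearStructure F)
    {e : ThCart} (v w : (tangent F).obj (op e)) (h : proj v = proj w) :
    S.comb v w h (unitVec 1) = w :=
  (S.add_comm _ _ _).trans (S.add_scale_zero (by rw [fn_constLine, unitVec_apply]; simp)
    (by rw [fn_constLine, unitVec_apply]; simp) h.symm _)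

lemma FiberwiseLinearStructure.comb_unitVec_add {F : PSh} (S : FiberwiseLinearStructure F)
    {e : ThCart} (v w : (tangent F).obj (op e)) (h : proj v = proj w) :
    S.comb v w h (unitVec 0 + unitVec 1) = S.add v w h := by
  refine S.add_congr (scale_one ?_ v) (scale_one ?_ w) _ <;>
    rw [fn_constLine, unitVec_add_apply, map_one]

/-- The combinations of two tangent vectors over `𝔻` depend smoothly on the coefficients. -/
lemma FiberwiseLinearStructure.exists_comb_plot {F : PSh} (S : FiberwiseLinearStructure F)
    {W : InfPoint} (v w : (tangent F).obj (op ⟨0, W⟩)) (h : proj v = proj w) :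
    ∃ z : (tangent F).obj (op ⟨2, W⟩), ∀ p : Eu 2,
      (tangent F).map (point ⟨2, W⟩ p).op z = S.comb v w h p := by
  let v' := (tangent F).map (toInf ⟨2, W⟩).op v
  let w' := (tangent F).map (toInf ⟨2, W⟩).op w
  have h' : proj v' = proj w' := by
    rw [proj_map, proj_map, h]
  have hpt : ∀ (p : Eu 2) (u : (tangent F).obj (op ⟨0, W⟩)),
      (tangent F).map (point ⟨2, W⟩ p).op ((tangent F).map (toInf ⟨2, W⟩).op u) = u := by
    intro p u
    have hc : (toInf ⟨2, W⟩).op ≫ (point ⟨2, W⟩ p).op = 𝟙 (op (⟨0, W⟩ : ThCart)) :=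
      congrArg Quiver.Hom.op (point_comp_toInf ⟨2, W⟩ p)
    exact ((tangent F).map_comp_apply _ _ u).symm.trans
      ((congrArg (fun t => (tangent F).map t u) hc).trans ((tangent F).map_id_apply _ u))
  have hfn : ∀ (p : Eu 2) (i : Fin 2), fn (point ⟨2, W⟩ p ≫ toLine ⟨2, W⟩ (coordFn i)) =
      fn (constLine ⟨0, W⟩ (p i)) := by
    intro p i
    rw [fn_comp, fn_toLine, fn_constLine]
    exact dual_point_incl ⟨2, W⟩ p (coordFn i)
  -- The combination with the coordinate functions of `ℝ^2` as coefficients; naturality of the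
  -- addition specialises it at each `p`.
  refine ⟨S.add (scale (toLine _ (coordFn 0)) v') (scale (toLine _ (coordFn 1)) w')
    (by rw [proj_scale, proj_scale, h']), fun p => ?_⟩
  rw [S.map_add]
  refine S.add_congr ?_ ?_ _
  · rw [map_scale, hpt]
    exact scale_congr (hfn p 0) v
  · rw [map_scale, hpt]
    exact scale_congr (hfn p 1) w

/-- Homogeneous maps `TF → ℝ` are linear for every fibrewise linear structure on `TF`. -/
lemma IsHomogeneous.isLinear {F : PSh} {f : tangent F ⟶ realLine} (hf : IsHomogeneous f)
    (S : FiberwiseLinearStructure F) : S.IsLinear f := by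
  refine ⟨hf, fun e v w h => fn_ext_point fun x => ?_⟩
  have h' : proj ((tangent F).map (point e x).op v) = proj ((tangent F).map (point e x).op w) := by
    rw [proj_map, proj_map, h]
  obtain ⟨z, hz⟩ := S.exists_comb_plot _ _ h'
  have key := hf.map_point_add z _ hz (fun r p => S.comb_smul _ _ h' r p) (unitVec 0) (unitVec 1)
  rw [S.comb_unitVec_zero, S.comb_unitVec_one, S.comb_unitVec_add] at key
  rw [map_add, ← fn_app_map, ← fn_app_map, ← fn_app_map, S.map_add]
  exact key

/-! ### The sheaf of 1-forms -/

/-- Scaling commutes with differentials of plots, and every tangent vector is the image of a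
universal one under such a differential. -/
lemma isHomogeneous_iff_toPlot {F : PSh} {f : tangent F ⟶ realLine} :
    IsHomogeneous f ↔ ∀ (e : ThCartᵒᵖ) (p : F.obj e),
      IsHomogeneous (tangentMap (yonedaEquiv.symm p) ≫ f) := by
  refine ⟨fun hf e p a r v => hf a r (v ≫ yonedaEquiv.symm p), fun h e r v => ?_⟩
  have hv := eq_universalPlot v
  have := h _ (toPlot v) e r (universalPlot e 1)
  rw [hv]
  exact this

/-- A section of `ℝ_{𝔻^1(1)}` that lies locally in `Ω̂¹` must lie in it. Only homogeneity needs
checking, and it is an equation of functions on `a`, testable on charts over which the tangent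
vector factors through the cover. -/
lemma isSheaf_OmegaHat : Presheaf.IsSheaf openTopology OmegaHat := by
  rw [isSheaf_iff_isSheaf_of_type]
  refine (omegaHat.isSheaf_iff ((isSheaf_iff_isSheaf_of_type _ _).1 isSheaf_realLineD)).2 ?_
  intro e s hs
  refine IsHomogeneous.isFiberwiseLinear (f := s) fun a r v => fn_ext_of_charts fun x => ?_
  obtain ⟨j, U, hj, hx, hS⟩ := exists_chart_toPlot hs v x
  refine ⟨j, U, hj, hx, ?_⟩
  refine (fn_app_map (F := tangent (yoneda.obj e.unop)) s (thicken a j hj.2.1) _).symm.trans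
    (Eq.trans ?_ (map_mul _ _ _).symm)
  refine Eq.trans ?_ (congrArg (dual (thicken a j hj.2.1) (fn r) * ·)
    (fn_app_map (F := tangent (yoneda.obj e.unop)) s (thicken a j hj.2.1) v))
  rw [map_scale]
  have h := hS.1 a (thicken a j hj.2.1 ≫ r) (universalPlot a 1)
  have hv := eq_universalPlot (n := 1) (F := yoneda.obj e.unop) (e := a)
    ((tangent (yoneda.obj e.unop)).map (thicken a j hj.2.1).op v)
  rw [hv]
  exact h

lemma isSheaf_of_isSheaf_openTopology {P : PSh} (h : Presheaf.IsSheaf openTopology P) :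
    Presheaf.IsSheaf goodTopology P :=
  fun X => Presieve.isSheaf_of_le _ goodTopology_le_openTopology (h X)

end ThSm

end

theorem mainTheorem12 :
    (Presheaf.IsSheaf ThSm.goodTopology ThSm.realLine ∧
      Presheaf.IsSheaf ThSm.goodTopology ThSm.realLineD ∧
      Presheaf.IsSheaf ThSm.goodTopology ThSm.OmegaHat ∧
      ∀ F : ThSm.ThSmoothSet, Presheaf.IsSheaf ThSm.goodTopology (ThSm.tangent F.obj)) ∧
    ∀ F : ThSm.ThSmoothSet,
      Function.Bijective
        (ThSm.transpose : (ThSm.tangent F.obj ⟶ ThSm.realLine) → (F.obj ⟶ ThSm.realLineD)) ∧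
      ∃ Φ : (F.obj ⟶ ThSm.OmegaHat) → (ThSm.tangent F.obj ⟶ ThSm.realLine),
        (∀ η, ThSm.transpose (Φ η) = η ≫ ThSm.omegaHatInclusion) ∧
        Function.Injective Φ ∧
        (ThSm.IsInfinitesimallyLinear F.obj →
          Set.range Φ = {f | ThSm.IsFiberwiseLinear f}) ∧
        (∀ S : ThSm.FiberwiseLinearStructure F.obj, Set.range Φ = {f | S.IsLinear f}) := by
  refine ⟨⟨ThSm.isSheaf_of_isSheaf_openTopology (ThSm.isSheaf_yoneda _),
    ThSm.isSheaf_of_isSheaf_openTopology ThSm.isSheaf_realLineD,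
    ThSm.isSheaf_of_isSheaf_openTopology ThSm.isSheaf_OmegaHat,
    fun F => ThSm.isSheaf_mapSpace _ F.property⟩, fun F => ⟨ThSm.transpose_bijective _, ?_⟩⟩
  let Φ : (F.obj ⟶ ThSm.OmegaHat) → (ThSm.tangent F.obj ⟶ ThSm.realLine) :=
    fun η => ThSm.untranspose (η ≫ ThSm.omegaHatInclusion)
  have hΦ : ∀ η, ThSm.transpose (Φ η) = η ≫ ThSm.omegaHatInclusion :=
    fun η => ThSm.transpose_untranspose _
  -- The image is described without any addition; both linearity statements then follow, since each
  -- notion of linearity amounts to homogeneity.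
  have hrange : Set.range Φ = {f | ThSm.IsHomogeneous f} := by
    ext f
    constructor
    · rintro ⟨η, rfl⟩
      refine ThSm.isHomogeneous_iff_toPlot.2 fun e p => ?_
      have h : (ThSm.transpose (Φ η)).app e p = (η.app e p).1 := by
        rw [hΦ]
        rfl
      have h' : ThSm.IsHomogeneous (show ThSm.tangent (yoneda.obj e.unop) ⟶ ThSm.realLine from
        (η.app e p).1) := (η.app e p).2.1
      rw [← h] at h'
      exact h'
    · intro hf
      -- The transpose of a homogeneous map takes values in homogeneous, hence fibrewise linear,
      -- maps, so it factors through `Ω̂¹`.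
      refine ⟨Subfunctor.lift (ThSm.transpose f) ?_, ThSm.transpose_injective _ ?_⟩
      · rintro e _ ⟨p, rfl⟩
        exact (ThSm.isHomogeneous_iff_toPlot.1 hf e p).isFiberwiseLinear
      · rw [hΦ]
        exact Subfunctor.lift_ι _ _
  refine ⟨Φ, hΦ, fun η η' h => ?_, fun _ => ?_, fun S => ?_⟩
  · have h1 : η ≫ ThSm.omegaHatInclusion = η' ≫ ThSm.omegaHatInclusion := by
      rw [← hΦ, ← hΦ, h]
    exact (cancel_mono _).1 h1
  · rw [hrange]
    exact Set.ext fun f => ⟨fun hf => ThSm.IsHomogeneous.isFiberwiseLinear hf, fun hf => hf.1⟩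
  · rw [hrange]
    exact Set.ext fun f => ⟨fun hf => ThSm.IsHomogeneous.isLinear hf S, fun hf => hf.1⟩
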